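/- Let $t\ge 2$, $h,g\in\mathbb{C}^t$ and $P\ge 0$. Consider the two-user multi-antenna Gaussian broadcast channel with confidential messages (MGBC-CM) $$y_{1,i}=h^{H}x_i+z_{1,i},\qquad y_{2,i}=g^{H}x_i+z_{2,i},\qquad i=1,\dots,n,$$ with inputs $x_i\in\mathbb{C}^t$, where all $z_{1,i},z_{2,i}$ are independent zero-mean, unit-variance circularly symmetric complex Gaussian variables, and where the input is subject to the average power constraint $\mathrm{tr}(K_X)\le P$, $K_X$ being the (block-averaged) input covariance matrix. A $(2^{nR_1},2^{nR_2},n)$ code consists of independent uniform messages $W_k\in\{1,\dots,2^{nR_k}\}$, $k=1,2$, a stochastic encoder $p(x^n|w_1,w_2)$ satisfying the power constraint, and deterministic decoders $\phi_k(Y_k^n)$ of $W_k$ at user $k$. A pair $(R_1,R_2)$ with $R_1,R_2\ge 0$ is achievable if for every $\epsilon>0$ there is such a code, for some $n\ge 1$, whose error probabilities at both users are at most $\epsilon$ and for which $$nR_1-H(W_1|Y_2^n)\le n\epsilon,\qquad nR_2-H(W_2|Y_1^n)\le n\epsilon$$ (entropies in bits). The secrecy capacity region $\mathcal{C}_s^{\rm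 MG}$ is the closure of the set of achievable pairs. For $\rho\in\mathbb{C}$ with $|\rho|\le 1$ and a Hermitian positive semidefinite $t\times t$ matrix $K_X$ put $$f_1(\rho,K_X)=\min_{\nu\in\mathbb{C}}\log_2\frac{(h-\nu g)^{H}K_X(h-\nu g)+\psi_1(\nu,\rho)}{1-|\rho|^2},\qquad f_2(\rho,K_X)=\min_{\mu\in\mathbb{C}}\log_2\frac{(g-\mu h)^{H}K_X(g-\mu h)+\psi_2(\mu,\rho)}{1-|\rho|^2},$$ $$\psi_1(\nu,\rho)=1+|\nu|^2-\nu^{*}\rho-\rho^{*}\nu,\qquad \psi_2(\mu,\rho)=1+|\mu|^2-\mu^{*}\rho-\rho^{*}\mu,$$ where, if $|\rho|=1$, $\log_2(a/0)$ is read as $+\infty$ for $a>0$ and as $0$ for $a=0$. Let $\mathcal{R}_{\rm O}^{\rm MG}(\rho,K_X)$ be the set of all pairs $(R_1,R_2)$ of real numbers with $0\le R_1\le f_1(\rho,K_X)$ and $0\le R_2\le f_2(\rho,K_X)$. Then the minima exist, and for every $\rho\in\mathbb{C}$ with $|\rho|\le 1$ $$\mathcal{C}_s^{\rm MG}\subseteq\bigcup_{K_X\succeq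 0,\ \mathrm{tr}(K_X)\le P}\mathcal{R}_{\rm O}^{\rm MG}(\rho,K_X).$$ -/

import Mathlib

open MeasureTheory ProbabilityTheory
open scoped ENNReal NNReal ComplexOrder

namespace MGBC

noncomputable section

/-- The inner product `vᴴ x` of two complex vectors. -/
def hdot {t : ℕ} (v x : Fin t → ℂ) : ℂ := star v ⬝ᵥ x

/-- The real number `vᴴ K v` (for Hermitian `K` this quantity is real). -/
def quadForm {t : ℕ} (K : Matrix (Fin t) (Fin t) ℂ) (v : Fin t → ℂ) : ℝ :=
  (star v ⬝ᵥ (K.mulVec v)).re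

/-! ### The channel and its codes -/

/-- The zero-mean, unit-variance (circularly symmetric) complex Gaussian law: real and imaginary
parts are independent real Gaussians of variance `1 / 2`. -/
def complexGaussian : Measure ℂ :=
  ((gaussianReal 0 (1 / 2)).prod (gaussianReal 0 (1 / 2))).map
    (fun p : ℝ × ℝ => (⟨p.1, p.2⟩ : ℂ))

/-- The law of the noise sequence `(z₁ᵢ, z₂ᵢ)`, `i = 1, …, n`: all `2 n` variables are independent
standard complex Gaussians. -/
def noiseLaw (n : ℕ) : Measure (Fin n → ℂ × ℂ) :=
  Measure.pi fun _ => complexGaussian.prod complexGaussian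

/-- A secret codebook of block length `n` with `M₁` and `M₂` messages for `t` transmit antennas:
a stochastic encoder and two deterministic decoders. -/
structure SecretCode (t n M₁ M₂ : ℕ) where
  /-- the conditional law of the block `xⁿ` given the message pair -/
  enc : Kernel (Fin M₁ × Fin M₂) (Fin n → Fin t → ℂ)
  markov : IsMarkovKernel enc
  /-- the decoder of user 1 -/
  dec₁ : (Fin n → ℂ) → Fin M₁
  /-- the decoder of user 2 -/
  dec₂ : (Fin n → ℂ) → Fin M₂
  measurable_dec₁ : Measurable dec₁
  measurable_dec₂ : Measurable dec₂

/-- The sample space: message pair, transmitted block, noise block. -/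
abbrev Sample (t n M₁ M₂ : ℕ) : Type :=
  ((Fin M₁ × Fin M₂) × (Fin n → Fin t → ℂ)) × (Fin n → ℂ × ℂ)

/-- The message of user 1. -/
def msg₁ {t n M₁ M₂ : ℕ} (ω : Sample t n M₁ M₂) : Fin M₁ := ω.1.1.1

/-- The message of user 2. -/
def msg₂ {t n M₁ M₂ : ℕ} (ω : Sample t n M₁ M₂) : Fin M₂ := ω.1.1.2

/-- The transmitted block `xⁿ`. -/
def input {t n M₁ M₂ : ℕ} (ω : Sample t n M₁ M₂) : Fin n → Fin t → ℂ := ω.1.2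

/-- The block received by user 1, `y₁ᵢ = hᴴ xᵢ + z₁ᵢ`. -/
def output₁ {t n M₁ M₂ : ℕ} (h : Fin t → ℂ) (ω : Sample t n M₁ M₂) : Fin n → ℂ :=
  fun i => hdot h (input ω i) + (ω.2 i).1

/-- The block received by user 2, `y₂ᵢ = gᴴ xᵢ + z₂ᵢ`. -/
def output₂ {t n M₁ M₂ : ℕ} (g : Fin t → ℂ) (ω : Sample t n M₁ M₂) : Fin n → ℂ :=
  fun i => hdot g (input ω i) + (ω.2 i).2

/-- The conditional entropy `H(W | Y)` in bits of a finitely valued `W` given an arbitrary random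
variable `Y`: the mean of the entropy of the conditional law of `W` given `Y`. -/
def condEntropy {Ω S T : Type*} [MeasurableSpace Ω] [Fintype S] [mT : MeasurableSpace T]
    (μ : Measure Ω) (W : Ω → S) (Y : Ω → T) : ℝ :=
  ∑ w : S, ∫ ω, Real.negMulLog
    ((μ⟦W ⁻¹' {w} | MeasurableSpace.comap Y mT⟧) ω) / Real.log 2 ∂μ

namespace SecretCode

variable {t n M₁ M₂ : ℕ}

/-- The joint law of messages (independent and uniform), transmitted block and noise. -/
def law (c : SecretCode t n M₁ M₂) : Measure (Sample t n M₁ M₂) :=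
  ((uniformOn (Set.univ : Set (Fin M₁ × Fin M₂))) ⊗ₘ c.enc).prod (noiseLaw n)

/-- The mean of coordinate `a` of the `i`-th channel input. -/
def inputMean (c : SecretCode t n M₁ M₂) (i : Fin n) (a : Fin t) : ℂ :=
  ∫ ω, input ω i a ∂c.law

/-- The channel input covariance matrix, averaged over the `n` channel uses. -/
def inputCov (c : SecretCode t n M₁ M₂) : Matrix (Fin t) (Fin t) ℂ :=
  Matrix.of fun a b => (1 / (n : ℂ)) * ∑ i : Fin n,
    ∫ ω, (input ω i a - c.inputMean i a) * star (input ω i b - c.inputMean i b) ∂c.law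

/-- The average power constraint `tr K_X ≤ P` (the inputs have finite second moments). -/
def PowerConstraint (c : SecretCode t n M₁ M₂) (P : ℝ) : Prop :=
  (∀ i a, MemLp (fun ω : Sample t n M₁ M₂ => input ω i a) 2 c.law) ∧
    (c.inputCov.trace).re ≤ P

/-- The error probability of user 1. -/
def err₁ (c : SecretCode t n M₁ M₂) (h : Fin t → ℂ) : ℝ :=
  c.law.real {ω | c.dec₁ (output₁ h ω) ≠ msg₁ ω}

/-- The error probability of user 2. -/
def err₂ (c : SecretCode t n M₁ M₂) (g : Fin t → ℂ) : ℝ :=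
  c.law.real {ω | c.dec₂ (output₂ g ω) ≠ msg₂ ω}

end SecretCode

/-- The number of messages in `{1, …, 2^{nR}}`. -/
def numMsg (n : ℕ) (R : ℝ) : ℕ := ⌊(2 : ℝ) ^ ((n : ℝ) * R)⌋₊

/-- A pair of (nonnegative) rates is achievable if, for every `ε > 0`, some code of these rates
meets the power constraint, has error probability at most `ε` at both users, and leaks at most
`n ε` bits of either message to the user it is not intended for. -/
def Achievable {t : ℕ} (h g : Fin t → ℂ) (P : ℝ) (R : ℝ × ℝ) : Prop :=
  0 ≤ R.1 ∧ 0 ≤ R.2 ∧ ∀ ε : ℝ, 0 < ε → ∃ n : ℕ, 1 ≤ n ∧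
    ∃ c : SecretCode t n (numMsg n R.1) (numMsg n R.2),
      c.PowerConstraint P ∧
      max (c.err₁ h) (c.err₂ g) ≤ ε ∧
      n * R.1 - condEntropy c.law msg₁ (output₂ g) ≤ n * ε ∧
      n * R.2 - condEntropy c.law msg₂ (output₁ h) ≤ n * ε

/-- The secrecy capacity region: the closure of the set of achievable rate pairs. -/
def secrecyCapacityRegion {t : ℕ} (h g : Fin t → ℂ) (P : ℝ) : Set (ℝ × ℝ) :=
  closure {R | Achievable h g P R}

/-! ### The outer bound -/

/-- `log₂ (a / d)` for `a, d ≥ 0`, with the limiting conventions for a vanishing denominator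
(`|ρ| = 1`): it is `+∞` for `a > 0`, and `0` for `a = 0`. -/
def logRatio (a d : ℝ) : EReal :=
  if d = 0 then (if a = 0 then 0 else ⊤) else ((Real.logb 2 (a / d) : ℝ) : EReal)

/-- `ψ(ν, ρ) = 1 + |ν|² - ν* ρ - ρ* ν`, a real number. -/
def psi (ν ρ : ℂ) : ℝ := 1 + ‖ν‖ ^ 2 - (star ν * ρ + star ρ * ν).re

/-- The expression that is minimized over `ν` in `f₁`. -/
def obj₁ {t : ℕ} (h g : Fin t → ℂ) (ρ : ℂ) (K : Matrix (Fin t) (Fin t) ℂ) (ν : ℂ) : EReal :=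
  logRatio (quadForm K (h - ν • g) + psi ν ρ) (1 - ‖ρ‖ ^ 2)

/-- The expression that is minimized over `μ` in `f₂`. -/
def obj₂ {t : ℕ} (h g : Fin t → ℂ) (ρ : ℂ) (K : Matrix (Fin t) (Fin t) ℂ) (μ : ℂ) : EReal :=
  logRatio (quadForm K (g - μ • h) + psi μ ρ) (1 - ‖ρ‖ ^ 2)

/-- The bound `f₁(ρ, K)` on the rate of user 1. -/
def f₁ {t : ℕ} (h g : Fin t → ℂ) (ρ : ℂ) (K : Matrix (Fin t) (Fin t) ℂ) : EReal :=
  ⨅ ν : ℂ, obj₁ h g ρ K ν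

/-- The bound `f₂(ρ, K)` on the rate of user 2. -/
def f₂ {t : ℕ} (h g : Fin t → ℂ) (ρ : ℂ) (K : Matrix (Fin t) (Fin t) ℂ) : EReal :=
  ⨅ μ : ℂ, obj₂ h g ρ K μ

/-- The rectangle of rate pairs with `0 ≤ R₁ ≤ f₁(ρ, K)` and `0 ≤ R₂ ≤ f₂(ρ, K)`. -/
def outerRegion {t : ℕ} (h g : Fin t → ℂ) (ρ : ℂ) (K : Matrix (Fin t) (Fin t) ℂ) :
    Set (ℝ × ℝ) :=
  {R | 0 ≤ R.1 ∧ (R.1 : EReal) ≤ f₁ h g ρ K ∧ 0 ≤ R.2 ∧ (R.2 : EReal) ≤ f₂ h g ρ K}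

end

end MGBC

namespace MGBC

/-! ### The standard complex Gaussian -/

/-! The argument is Sato's. Error probability and leakage depend on the two outputs only through the
joint law of the inputs and messages with each output separately, so the noises may be coupled at
will. For user 1 replace `z₁` by `ρ z₂ + s u` with `s² = 1 - |ρ|²` and `u` an independent standard
Gaussian. For the coupled outputs, `H(W₁|Y₂) ≤ H(W₁|Y₁) + I(W₁;Y₁|Y₂)`. Fano's inequality controls
the first term. The second is at most `n` times the logarithm of the mean square error of any affine
estimate `ν Y₂ + c` of `Y₁`, divided by the variance `s²` of the part of the noise that `Y₂` cannot
reveal. With `c` chosen to remove means, that error is the quadratic form of the input covariance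
plus `ψ`. User 2 is symmetric.

Differential entropies never appear. One Gibbs inequality, `condEntropy_le_of_forall_test`, bounds
`H(W|Y)` by the mean of any `V` passing an exponential moment test. In
`condEntropy_le_integral_sub_log_add` the test is passed by `V = -log r(W|Y₁) +` (log-density ratio
of `CN(A + ρ z, s²)` to `CN(ν Y₂ + c, σ²)`): the density ratio trades the true law of `Y₁` for one
determined by `Y₂`. `condEntropy_le_of_decoder` then picks `r` and `σ`, giving Fano's term and the
logarithm together, and `condEntropy_le_of_channels` rewrites the result in terms of `K_X`.

A code has one covariance matrix, which serves every `ρ` and `ν`. Positive semidefinite matrices of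
bounded trace form a compact set, so a limit matrix serves a rate pair in the closure, for all `|ρ|
< 1` at once. This uniformity yields the boundary case `|ρ| = 1`, by applying the bound at `s ρ` and
letting `s → 1`. -/

theorem measurable_mk_complex : Measurable fun p : ℝ × ℝ => (⟨p.1, p.2⟩ : ℂ) :=
  Complex.measurableEquivRealProd.symm.measurable

instance : IsProbabilityMeasure complexGaussian :=
  Measure.isProbabilityMeasure_map measurable_mk_complex.aemeasurable

theorem lintegral_complexGaussian {F : ℂ → ℝ≥0∞} (hF : Measurable F) :
    ∫⁻ z, F z ∂complexGaussian =
      ∫⁻ z, F z * ENNReal.ofReal (Real.pi⁻¹ * Real.exp (-‖z‖ ^ 2)) := by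
  have hv : (1 / 2 : ℝ≥0) ≠ 0 := by norm_num
  have hD : Measurable fun p : ℝ × ℝ => gaussianPDF 0 (1 / 2) p.1 * gaussianPDF 0 (1 / 2) p.2 :=
    ((measurable_gaussianPDF _ _).comp measurable_fst).mul
      ((measurable_gaussianPDF _ _).comp measurable_snd)
  have hF' : Measurable fun p : ℝ × ℝ => F ⟨p.1, p.2⟩ := hF.comp measurable_mk_complex
  rw [complexGaussian, lintegral_map hF measurable_mk_complex,
    gaussianReal_of_var_ne_zero _ hv,
    prod_withDensity (measurable_gaussianPDF _ _) (measurable_gaussianPDF _ _),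
    lintegral_withDensity_eq_lintegral_mul _ hD hF']
  change ∫⁻ p : ℝ × ℝ, _ ∂volume = _
  rw [← Complex.volume_preserving_equiv_real_prod.lintegral_comp (hD.mul hF')]
  refine lintegral_congr fun z => ?_
  simp only [Pi.mul_apply, Complex.measurableEquivRealProd_apply, Complex.eta, gaussianPDF]
  rw [mul_comm, ← ENNReal.ofReal_mul (gaussianPDFReal_nonneg _ _ _)]
  congr 2
  have hz : ‖z‖ ^ 2 = z.re ^ 2 + z.im ^ 2 := by
    rw [← Complex.normSq_eq_norm_sq, Complex.normSq_apply]; ring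
  have h2 : (2 : ℝ) * Real.pi * (1 / 2) = Real.pi := by ring
  simp only [gaussianPDFReal, NNReal.coe_div, NNReal.coe_one, NNReal.coe_ofNat, h2]
  rw [mul_mul_mul_comm, ← Real.exp_add, ← mul_inv, Real.mul_self_sqrt Real.pi_pos.le, hz]
  congr 2
  ring

/-- The Jacobian is `s²`, not `s`, because `ℂ` has real dimension two. -/
theorem lintegral_complex_comp_affine (m : ℂ) {s : ℝ} (hs : 0 < s) {F : ℂ → ℝ≥0∞}
    (hF : Measurable F) :
    ∫⁻ z : ℂ, F (m + s * z) = ENNReal.ofReal ((s ^ 2)⁻¹) * ∫⁻ z : ℂ, F z := by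
  have h1 : ∫⁻ z : ℂ, F (m + s * z) = ∫⁻ z : ℂ, (fun y => F (m + y)) (s • z) := by
    simp [Complex.real_smul]
  rw [h1, ← lintegral_map (f := fun y => F (m + y)) (g := fun z : ℂ => s • z)
    (by fun_prop) (by fun_prop), Measure.map_addHaar_smul _ hs.ne', lintegral_smul_measure,
    lintegral_add_left_eq_self, Complex.finrank_real_complex, abs_of_pos (by positivity),
    smul_eq_mul]

/-- The log-ratio of the densities of `CN(m, s²)` and `CN(m', σ²)` at `m + s z`. -/
noncomputable def logDensityRatio (s σ : ℝ) (m m' z : ℂ) : ℝ :=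
  Real.log (σ ^ 2 / s ^ 2) - ‖z‖ ^ 2 + ‖m + s * z - m'‖ ^ 2 / σ ^ 2

theorem measurable_logDensityRatio (s σ : ℝ) (m m' : ℂ) :
    Measurable (logDensityRatio s σ m m') := by
  unfold logDensityRatio; fun_prop

/-- Weighting by the inverse density ratio turns an expectation under `CN(m, s²)` into one under
`CN(m', σ²)`; both sides are reduced to Lebesgue integrals by affine substitution. -/
theorem lintegral_exp_neg_logDensityRatio {s σ : ℝ} (hs : 0 < s) (hσ : 0 < σ) (m m' : ℂ)
    {F : ℂ → ℝ≥0∞} (hF : Measurable F) :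
    ∫⁻ z, F (m + s * z) * ENNReal.ofReal (Real.exp (-logDensityRatio s σ m m' z))
      ∂complexGaussian = ∫⁻ u, F (m' + σ * u) ∂complexGaussian := by
  have hR := measurable_logDensityRatio s σ m m'
  rw [lintegral_complexGaussian (by fun_prop), lintegral_complexGaussian (by fun_prop)]
  have key : ∀ (a : ℂ) (r : ℝ) (_ : 0 < r) (z : ℂ),
      F (a + r * z) * ENNReal.ofReal (Real.pi⁻¹ * Real.exp (-‖z‖ ^ 2)) =
        (fun y => F y * ENNReal.ofReal (Real.pi⁻¹ * Real.exp (-(‖y - a‖ ^ 2 / r ^ 2))))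
          (a + r * z) := by
    intro a r hr z
    have : ‖z‖ ^ 2 = ‖a + r * z - a‖ ^ 2 / r ^ 2 := by
      rw [add_sub_cancel_left, norm_mul, Complex.norm_real, mul_pow, Real.norm_eq_abs, sq_abs]
      field_simp
    simp only [← this]
  have key2 : ∀ z : ℂ, F (m + s * z) * ENNReal.ofReal (Real.exp (-logDensityRatio s σ m m' z)) *
        ENNReal.ofReal (Real.pi⁻¹ * Real.exp (-‖z‖ ^ 2)) =
      (fun y => F y * ENNReal.ofReal (s ^ 2 / σ ^ 2 *
        (Real.pi⁻¹ * Real.exp (-(‖y - m'‖ ^ 2 / σ ^ 2))))) (m + s * z) := by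
    intro z
    rw [mul_assoc, ← ENNReal.ofReal_mul (Real.exp_pos _).le]
    simp only
    congr 2
    have : -logDensityRatio s σ m m' z =
        ‖z‖ ^ 2 + (-(‖m + s * z - m'‖ ^ 2 / σ ^ 2) - Real.log (σ ^ 2 / s ^ 2)) := by
      unfold logDensityRatio; ring
    rw [this, Real.exp_add, Real.exp_sub, Real.exp_log (by positivity), Real.exp_neg (‖z‖ ^ 2)]
    field_simp
  simp_rw [key m' σ hσ, key2]
  rw [lintegral_complex_comp_affine m hs (F := fun y => F y * ENNReal.ofReal (s ^ 2 / σ ^ 2 *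
      (Real.pi⁻¹ * Real.exp (-(‖y - m'‖ ^ 2 / σ ^ 2))))) (by fun_prop),
    lintegral_complex_comp_affine m' hσ (F := fun y => F y *
      ENNReal.ofReal (Real.pi⁻¹ * Real.exp (-(‖y - m'‖ ^ 2 / σ ^ 2)))) (by fun_prop)]
  simp_rw [ENNReal.ofReal_mul (show 0 ≤ s ^ 2 / σ ^ 2 by positivity), mul_left_comm (F _)]
  rw [lintegral_const_mul _ (by fun_prop), ← mul_assoc, ← ENNReal.ofReal_mul (by positivity)]
  congr 2
  field_simp

theorem lintegral_pi_exp_neg_sum_logDensityRatio {n : ℕ} {s σ : ℝ} (hs : 0 < s) (hσ : 0 < σ)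
    (m m' : Fin n → ℂ) {F : (Fin n → ℂ) → ℝ≥0∞} (hF : Measurable F) :
    ∫⁻ z, F (fun i => m i + s * z i) *
        ENNReal.ofReal (Real.exp (-∑ i, logDensityRatio s σ (m i) (m' i) (z i)))
      ∂Measure.pi (fun _ => complexGaussian) =
      ∫⁻ u, F (fun i => m' i + σ * u i) ∂Measure.pi (fun _ => complexGaussian) := by
  have hR : ∀ i, Measurable (logDensityRatio s σ (m i) (m' i)) :=
    fun i => measurable_logDensityRatio s σ _ _
  have hS : Measurable fun z : Fin n → ℂ =>
      ENNReal.ofReal (Real.exp (-∑ i, logDensityRatio s σ (m i) (m' i) (z i))) := by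
    refine ENNReal.measurable_ofReal.comp (Real.measurable_exp.comp (Measurable.neg ?_))
    exact Finset.measurable_sum _ fun i _ => (hR i).comp (measurable_pi_apply i)
  have hT : Measurable fun (z : Fin n → ℂ) i => m i + s * z i := by fun_prop
  have hT' : ∀ i, AEMeasurable (fun z : ℂ => m' i + σ * z) complexGaussian :=
    fun i => by fun_prop
  have hprob : ∀ i, IsProbabilityMeasure (complexGaussian.map fun z : ℂ => m' i + σ * z) :=
    fun i => Measure.isProbabilityMeasure_map (hT' i)
  -- `F` need not factor over coordinates, so the identity is proved for measures, where boxes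
  -- suffice and everything factors.
  have hmeas : ((Measure.pi fun _ : Fin n => complexGaussian).withDensity fun z =>
        ENNReal.ofReal (Real.exp (-∑ i, logDensityRatio s σ (m i) (m' i) (z i)))).map
          (fun z i => m i + s * z i) =
      (Measure.pi fun _ : Fin n => complexGaussian).map (fun u i => m' i + σ * u i) := by
    rw [Measure.pi_map_pi (f := fun i z => m' i + σ * z) hT']
    refine (Measure.pi_eq fun S hS' => ?_).symm
    rw [Measure.map_apply hT (.univ_pi hS'),
      withDensity_apply _ (hT (.univ_pi hS')), ← lintegral_indicator (hT (.univ_pi hS'))]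
    have hfac : ∀ z : Fin n → ℂ, ((fun (z : Fin n → ℂ) i => m i + s * z i) ⁻¹'
          Set.univ.pi S).indicator (fun z => ENNReal.ofReal
            (Real.exp (-∑ i, logDensityRatio s σ (m i) (m' i) (z i)))) z =
        ∏ i, (S i).indicator 1 (m i + s * z i) *
          ENNReal.ofReal (Real.exp (-logDensityRatio s σ (m i) (m' i) (z i))) := by
      intro z
      rw [Finset.prod_mul_distrib, ← ENNReal.ofReal_prod_of_nonneg
        (fun i _ => (Real.exp_pos _).le), ← Real.exp_sum, Finset.sum_neg_distrib]
      by_cases hz : ∀ i, m i + s * z i ∈ S i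
      · rw [Set.indicator_of_mem (by simpa [Set.mem_pi] using hz),
          Finset.prod_eq_one fun i _ => by rw [Set.indicator_of_mem (hz i), Pi.one_apply], one_mul]
      · rw [Set.indicator_of_notMem (by simpa [Set.mem_pi] using hz)]
        push Not at hz
        obtain ⟨i, hi⟩ := hz
        rw [Finset.prod_eq_zero (Finset.mem_univ i) (Set.indicator_of_notMem hi _), zero_mul]
    simp_rw [hfac]
    have hX : ∀ i, Measurable fun w : ℂ => (S i).indicator (1 : ℂ → ℝ≥0∞) (m i + s * w) *
        ENNReal.ofReal (Real.exp (-logDensityRatio s σ (m i) (m' i) w)) := by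
      intro i
      have h1 : Measurable ((S i).indicator (1 : ℂ → ℝ≥0∞)) := measurable_one.indicator (hS' i)
      have := hR i
      fun_prop
    rw [lintegral_prod_eq_prod_lintegral_of_indepFun Finset.univ
      (fun i (z : Fin n → ℂ) => (S i).indicator (1 : ℂ → ℝ≥0∞) (m i + s * z i) *
        ENNReal.ofReal (Real.exp (-logDensityRatio s σ (m i) (m' i) (z i))))
      (iIndepFun_pi fun i => (hX i).aemeasurable)
      (fun i => (hX i).comp (measurable_pi_apply i))]
    refine Finset.prod_congr rfl fun i _ => ?_
    rw [(measurePreserving_eval (fun _ : Fin n => complexGaussian) i).lintegral_comp (hX i),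
      lintegral_exp_neg_logDensityRatio hs hσ _ _ (measurable_one.indicator (hS' i)),
      ← lintegral_map (measurable_one.indicator (hS' i)) (by fun_prop),
      lintegral_indicator_one (hS' i)]
  calc _ = ∫⁻ y, F y ∂(((Measure.pi fun _ : Fin n => complexGaussian).withDensity fun z =>
        ENNReal.ofReal (Real.exp (-∑ i, logDensityRatio s σ (m i) (m' i) (z i)))).map
          (fun z i => m i + s * z i)) := by
        rw [lintegral_map hF hT, lintegral_withDensity_eq_lintegral_mul _ hS
          (show Measurable fun z : Fin n → ℂ => F fun i => m i + s * z i from hF.comp hT)]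
        exact lintegral_congr fun z => mul_comm _ _
    _ = _ := by rw [hmeas, lintegral_map hF (by fun_prop)]

theorem memLp_id_complexGaussian : MemLp (fun z : ℂ => z) 2 complexGaussian := by
  have hc : Measurable fun z : ℂ => z := measurable_id
  unfold complexGaussian
  rw [memLp_map_measure_iff hc.aestronglyMeasurable measurable_mk_complex.aemeasurable]
  have h1 : MemLp (fun p : ℝ × ℝ => p.1) 2
      ((gaussianReal 0 (1 / 2)).prod (gaussianReal 0 (1 / 2))) :=
    (memLp_id_gaussianReal (μ := 0) (v := 1 / 2) 2).comp_measurePreserving measurePreserving_fst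
  have h2 : MemLp (fun p : ℝ × ℝ => p.2) 2
      ((gaussianReal 0 (1 / 2)).prod (gaussianReal 0 (1 / 2))) :=
    (memLp_id_gaussianReal (μ := 0) (v := 1 / 2) 2).comp_measurePreserving measurePreserving_snd
  have := h1.ofReal (K := ℂ) |>.add ((h2.ofReal (K := ℂ)).const_mul Complex.I)
  refine this.congr_norm (measurable_mk_complex.aestronglyMeasurable) (ae_of_all _ fun p => ?_)
  congr 1
  apply Complex.ext <;> simp

theorem integral_complexGaussian_re : ∫ z, z.re ∂complexGaussian = 0 := by
  unfold complexGaussian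
  rw [integral_map measurable_mk_complex.aemeasurable (by fun_prop)]
  rw [integral_fun_fst (fun x : ℝ => x)]
  simp [integral_id_gaussianReal]

theorem integral_complexGaussian_im : ∫ z, z.im ∂complexGaussian = 0 := by
  unfold complexGaussian
  rw [integral_map measurable_mk_complex.aemeasurable (by fun_prop)]
  rw [integral_fun_snd (fun x : ℝ => x)]
  simp [integral_id_gaussianReal]

theorem integral_id_complexGaussian : ∫ z, z ∂complexGaussian = 0 := by
  have hi := memLp_id_complexGaussian.integrable one_le_two
  apply Complex.ext
  · rw [← RCLike.re_eq_complex_re, ← integral_re hi]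
    exact integral_complexGaussian_re
  · rw [← RCLike.im_eq_complex_im, ← integral_im hi]
    exact integral_complexGaussian_im

theorem integral_norm_sq_complexGaussian : ∫ z, ‖z‖ ^ 2 ∂complexGaussian = 1 := by
  have hg : ∫ x, x ^ 2 ∂gaussianReal 0 (1 / 2) = 1 / 2 := by
    have := variance_fun_id_gaussianReal (μ := 0) (v := 1 / 2)
    rw [variance_of_integral_eq_zero (by fun_prop) (by simp [integral_id_gaussianReal])] at this
    simpa using this
  have hint : Integrable (fun x : ℝ => x ^ 2) (gaussianReal 0 (1 / 2)) :=
    (memLp_id_gaussianReal (μ := 0) (v := 1 / 2) 2).integrable_sq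
  unfold complexGaussian
  rw [integral_map measurable_mk_complex.aemeasurable (by fun_prop)]
  have : ∀ p : ℝ × ℝ, ‖(⟨p.1, p.2⟩ : ℂ)‖ ^ 2 = p.1 ^ 2 + p.2 ^ 2 := by
    intro p; rw [← Complex.normSq_eq_norm_sq, Complex.normSq_apply]; ring
  simp_rw [this]
  rw [integral_add (hint.comp_fst _) (hint.comp_snd _), integral_fun_fst (fun x : ℝ => x ^ 2),
    integral_fun_snd (fun x : ℝ => x ^ 2), hg]
  norm_num

theorem charFun_complexGaussian (t : ℂ) :
    charFun complexGaussian t = Complex.exp (-(‖t‖ ^ 2 / 4 : ℝ)) := by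
  rw [charFun_apply]
  unfold complexGaussian
  rw [integral_map measurable_mk_complex.aemeasurable (by fun_prop)]
  have h : ∀ p : ℝ × ℝ, Complex.exp ((inner ℝ (⟨p.1, p.2⟩ : ℂ) t : ℝ) * Complex.I) =
      Complex.exp (t.re * p.1 * Complex.I) * Complex.exp (t.im * p.2 * Complex.I) := by
    intro p
    rw [← Complex.exp_add, Complex.inner]
    congr 1
    simp
    ring
  simp_rw [h]
  rw [integral_prod_mul (fun x : ℝ => Complex.exp (t.re * x * Complex.I))
    (fun x : ℝ => Complex.exp (t.im * x * Complex.I)), ← charFun_apply_real,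
    ← charFun_apply_real, charFun_gaussianReal, charFun_gaussianReal, ← Complex.exp_add]
  congr 1
  rw [← Complex.normSq_eq_norm_sq, Complex.normSq_apply]
  push_cast
  ring

/-- This is what permits an arbitrary noise correlation: the coupled noise `ρ z + s u` keeps the
standard marginal law. Characteristic functions multiply, and the exponents add up to `|ρ|² + s² =
1`. -/
theorem map_combination_complexGaussian {s : ℝ} {ρ : ℂ} (h : ‖ρ‖ ^ 2 + s ^ 2 = 1) :
    (complexGaussian.prod complexGaussian).map (fun p : ℂ × ℂ => ρ * p.1 + s * p.2) =
      complexGaussian := by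
  have hm : Measurable fun p : ℂ × ℂ => ρ * p.1 + s * p.2 := by fun_prop
  have : IsProbabilityMeasure ((complexGaussian.prod complexGaussian).map
      (fun p : ℂ × ℂ => ρ * p.1 + s * p.2)) := Measure.isProbabilityMeasure_map hm.aemeasurable
  refine Measure.ext_of_charFun (funext fun t => ?_)
  rw [charFun_apply, integral_map hm.aemeasurable (by fun_prop)]
  have h' : ∀ p : ℂ × ℂ, Complex.exp ((inner ℝ (ρ * p.1 + s * p.2) t : ℝ) * Complex.I) =
      Complex.exp ((inner ℝ p.1 (star ρ * t) : ℝ) * Complex.I) *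
        Complex.exp ((inner ℝ p.2 (s * t) : ℝ) * Complex.I) := by
    intro p
    rw [← Complex.exp_add, ← add_mul, ← Complex.ofReal_add]
    congr 3
    simp only [Complex.inner]
    simp
    ring
  simp_rw [h']
  rw [integral_prod_mul (fun x : ℂ => Complex.exp ((inner ℝ x (star ρ * t) : ℝ) * Complex.I))
    (fun x : ℂ => Complex.exp ((inner ℝ x (s * t) : ℝ) * Complex.I)), ← charFun_apply,
    ← charFun_apply, charFun_complexGaussian, charFun_complexGaussian, charFun_complexGaussian,
    ← Complex.exp_add]
  congr 1
  rw [norm_mul, norm_mul, norm_star, mul_pow, mul_pow, Complex.norm_real, Real.norm_eq_abs, sq_abs,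
    ← Complex.ofReal_neg, ← Complex.ofReal_neg, ← Complex.ofReal_neg, ← Complex.ofReal_add]
  congr 1
  linear_combination (-‖t‖ ^ 2 / 4) * h

theorem map_combination_pi_complexGaussian (n : ℕ) {s : ℝ} {ρ : ℂ} (h : ‖ρ‖ ^ 2 + s ^ 2 = 1) :
    ((Measure.pi fun _ : Fin n => complexGaussian).prod
      (Measure.pi fun _ : Fin n => complexGaussian)).map
        (fun p i => ρ * p.1 i + s * p.2 i) = Measure.pi fun _ : Fin n => complexGaussian := by
  have e := measurePreserving_arrowProdEquivProdArrow ℂ ℂ (Fin n)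
    (fun _ => complexGaussian) (fun _ => complexGaussian)
  rw [← e.map_eq, Measure.map_map (by fun_prop) e.measurable]
  have hm : ∀ _ : Fin n, AEMeasurable (fun p : ℂ × ℂ => ρ * p.1 + s * p.2)
    (complexGaussian.prod complexGaussian) := fun _ => by fun_prop
  have hp : ∀ _ : Fin n, SigmaFinite ((complexGaussian.prod complexGaussian).map
      fun p : ℂ × ℂ => ρ * p.1 + s * p.2) := fun _ => by
    rw [map_combination_complexGaussian h]; infer_instance
  have := Measure.pi_map_pi hm
  simp_rw [map_combination_complexGaussian h] at this
  exact this

/-! ### Conditional entropy -/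

theorem measurable_uncurry_of_fintype {S T E : Type*} [Finite S] [MeasurableSpace S]
    [DiscreteMeasurableSpace S] [MeasurableSpace T] [MeasurableSpace E] {g : S → T → E}
    (hg : ∀ w, Measurable (g w)) : Measurable fun p : T × S => g p.2 p.1 :=
  measurable_from_prod_countable_left hg

section Entropy

variable {Ω S T : Type*} [MeasurableSpace Ω] [Fintype S] [Nonempty S] [MeasurableSpace S]
  [DiscreteMeasurableSpace S] [MeasurableSpace T]

theorem condEntropy_mul_log_two (μ : Measure Ω) [IsProbabilityMeasure μ] {W : Ω → S} {Y : Ω → T}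
    (hW : Measurable W) (hY : Measurable Y) :
    condEntropy μ W Y * Real.log 2 =
      ∑ w, ∫ ω, Real.negMulLog ((condDistrib W Y μ (Y ω)).real {w}) ∂μ := by
  unfold condEntropy
  rw [Finset.sum_mul]
  refine Finset.sum_congr rfl fun w _ => ?_
  rw [integral_div, div_mul_cancel₀ _ (Real.log_pos one_lt_two).ne']
  refine integral_congr_ae ?_
  filter_upwards [condDistrib_ae_eq_condExp (μ := μ) hY hW (measurableSet_singleton w)] with ω hω
  rw [hω]

/-- Sato's observation for the equivocation: it sees only the joint law of message and output, hence
is blind to the coupling of the noises. -/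
theorem condEntropy_congr_law {Ω' : Type*} [MeasurableSpace Ω'] {μ : Measure Ω}
    [IsProbabilityMeasure μ] {μ' : Measure Ω'} [IsProbabilityMeasure μ'] {W : Ω → S} {Y : Ω → T}
    {W' : Ω' → S} {Y' : Ω' → T} (hW : Measurable W) (hY : Measurable Y) (hW' : Measurable W')
    (hY' : Measurable Y')
    (h : μ.map (fun ω => (Y ω, W ω)) = μ'.map (fun ω => (Y' ω, W' ω))) :
    condEntropy μ W Y = condEntropy μ' W' Y' := by
  have hlog := (Real.log_pos one_lt_two).ne'
  refine mul_right_cancel₀ hlog ?_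
  rw [condEntropy_mul_log_two μ hW hY, condEntropy_mul_log_two μ' hW' hY']
  have hk : condDistrib W Y μ = condDistrib W' Y' μ' := by
    rw [condDistrib, condDistrib]
    congr 1
  have hm : μ.map Y = μ'.map Y' := by
    rw [← Measure.fst_map_prodMk hW, ← Measure.fst_map_prodMk hW', h]
  refine Finset.sum_congr rfl fun w _ => ?_
  have hmeas : Measurable fun y => Real.negMulLog ((condDistrib W' Y' μ' y).real {w}) :=
    Real.continuous_negMulLog.measurable.comp
      (Kernel.measurable_coe _ (measurableSet_singleton w)).ennreal_toReal
  rw [hk, ← integral_map (f := fun y => Real.negMulLog ((condDistrib W' Y' μ' y).real {w}))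
    hY.aemeasurable hmeas.aestronglyMeasurable, hm, integral_map hY'.aemeasurable
    hmeas.aestronglyMeasurable]

/-- Packages the conditional distribution of `W` given `Y` as honest functions `a w y`, together
with the tower property in both Bochner and `ℝ≥0∞` form: the former for the logarithm, the latter
for test functions not yet known to be integrable. -/
theorem exists_posterior (μ : Measure Ω) [IsProbabilityMeasure μ] {W : Ω → S} {Y : Ω → T}
    (hW : Measurable W) (hY : Measurable Y) :
    ∃ a : S → T → ℝ, (∀ w, Measurable (a w)) ∧ (∀ w y, 0 ≤ a w y) ∧ (∀ w y, a w y ≤ 1) ∧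
      condEntropy μ W Y * Real.log 2 = ∑ w, ∫ ω, Real.negMulLog (a w (Y ω)) ∂μ ∧
      (∀ g : S → T → ℝ, (∀ w, Measurable (g w)) → Integrable (fun ω => g (W ω) (Y ω)) μ →
        ∫ ω, g (W ω) (Y ω) ∂μ = ∫ ω, ∑ w, a w (Y ω) * g w (Y ω) ∂μ) ∧
      ∀ g : S → T → ℝ≥0∞, (∀ w, Measurable (g w)) →
        ∫⁻ ω, g (W ω) (Y ω) ∂μ = ∫⁻ ω, ∑ w, ENNReal.ofReal (a w (Y ω)) * g w (Y ω) ∂μ := by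
  have ha : ∀ w, Measurable fun y => (condDistrib W Y μ y).real {w} := fun w =>
    (Kernel.measurable_coe _ (measurableSet_singleton w)).ennreal_toReal
  have hYW : Measurable fun ω => (Y ω, W ω) := hY.prodMk hW
  refine ⟨fun w y => (condDistrib W Y μ y).real {w}, ha, fun w y => measureReal_nonneg,
    fun w y => measureReal_le_one, condEntropy_mul_log_two μ hW hY, fun g hg hi => ?_,
    fun g hg => ?_⟩
  · have hg' := measurable_uncurry_of_fintype hg
    have hi' : Integrable (fun p : T × S => g p.2 p.1) (μ.map fun ω => (Y ω, W ω)) :=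
      (integrable_map_measure hg'.aestronglyMeasurable hYW.aemeasurable).2 hi
    have hm : Measurable fun y => ∑ w, (condDistrib W Y μ y).real {w} * g w y :=
      Finset.measurable_sum _ fun w _ => (ha w).mul (hg w)
    rw [← integral_map (f := fun p : T × S => g p.2 p.1) hYW.aemeasurable
      hg'.aestronglyMeasurable, ← integral_map (f := fun y =>
        ∑ w, (condDistrib W Y μ y).real {w} * g w y) hY.aemeasurable hm.aestronglyMeasurable]
    rw [← compProd_map_condDistrib hW.aemeasurable] at hi' ⊢
    rw [Measure.integral_compProd hi']
    refine integral_congr_ae (ae_of_all _ fun y => ?_)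
    simp only
    rw [integral_fintype (.of_finite)]
    simp
  · have hg' := measurable_uncurry_of_fintype hg
    have hm : Measurable fun y => ∑ w, ENNReal.ofReal ((condDistrib W Y μ y).real {w}) * g w y :=
      Finset.measurable_sum _ fun w _ => (ha w).ennreal_ofReal.mul (hg w)
    rw [← lintegral_map (f := fun p : T × S => g p.2 p.1) hg' hYW,
      ← lintegral_map (f := fun y =>
        ∑ w, ENNReal.ofReal ((condDistrib W Y μ y).real {w}) * g w y) hm hY,
      ← compProd_map_condDistrib hW.aemeasurable, Measure.lintegral_compProd hg']
    refine lintegral_congr fun y => ?_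
    rw [lintegral_fintype]
    refine Finset.sum_congr rfl fun w _ => ?_
    rw [mul_comm, ofReal_measureReal]

/-- The shift by `δ` costs at most `x · δ / x = δ` and makes the logarithm bounded on `[0, 1]`, so
posteriors equal to zero cause no trouble. -/
theorem negMulLog_le_mul_neg_log_add {x δ : ℝ} (hx : 0 ≤ x) (hδ : 0 < δ) :
    Real.negMulLog x ≤ x * -Real.log (x + δ) + δ := by
  rcases hx.eq_or_lt with rfl | hx
  · simpa using hδ.le
  have h1 : Real.log (x + δ) - Real.log x ≤ δ / x := by
    rw [← Real.log_div (by positivity) hx.ne']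
    refine (Real.log_le_sub_one_of_pos (by positivity)).trans_eq ?_
    field_simp
    ring
  have h2 := mul_le_mul_of_nonneg_left h1 hx.le
  rw [mul_div_cancel₀ _ hx.ne'] at h2
  simp only [Real.negMulLog]
  nlinarith

theorem abs_log_add_le {x δ : ℝ} (hx : 0 ≤ x) (hx1 : x ≤ 1) (hδ : 0 < δ) :
    |Real.log (x + δ)| ≤ |Real.log δ| + |Real.log (1 + δ)| := by
  have h1 : Real.log δ ≤ Real.log (x + δ) := Real.log_le_log hδ (by linarith)
  have h2 : Real.log (x + δ) ≤ Real.log (1 + δ) := Real.log_le_log (by linarith) (by linarith)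
  rw [abs_le]
  constructor
  · linarith [neg_abs_le (Real.log δ), abs_nonneg (Real.log (1 + δ))]
  · linarith [le_abs_self (Real.log (1 + δ)), abs_nonneg (Real.log δ)]

/-- A variational (Gibbs) bound: if the mean of `e^{-V} / (a + δ)`, `a` the posterior probability
of `W` given `Y`, is at most one for each `δ`, then the mean of `V` bounds the entropy of `W` given
`Y`. -/
theorem condEntropy_le_of_forall_test {μ : Measure Ω} [IsProbabilityMeasure μ] {W : Ω → S}
    {Y : Ω → T} (hW : Measurable W) (hY : Measurable Y) {V : Ω → ℝ} (hV : Integrable V μ)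
    (hVm : Measurable V)
    (h : ∀ a : S → T → ℝ, (∀ w, Measurable (a w)) → (∀ w y, 0 ≤ a w y) →
      (∀ g : S → T → ℝ≥0∞, (∀ w, Measurable (g w)) →
        ∫⁻ ω, g (W ω) (Y ω) ∂μ = ∫⁻ ω, ∑ w, ENNReal.ofReal (a w (Y ω)) * g w (Y ω) ∂μ) →
      ∀ δ : ℝ, 0 < δ →
        ∫⁻ ω, ENNReal.ofReal ((a (W ω) (Y ω) + δ)⁻¹) * ENNReal.ofReal (Real.exp (-V ω)) ∂μ ≤ 1) :
    condEntropy μ W Y * Real.log 2 ≤ ∫ ω, V ω ∂μ := by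
  obtain ⟨a, ham, ha0, ha1, hent, hint, hlint⟩ := exists_posterior μ hW hY
  -- Regularizing the posterior costs `δ` per message value, which vanishes as `δ → 0` because `S`
  -- is finite.
  suffices hδ : ∀ δ : ℝ, 0 < δ →
      condEntropy μ W Y * Real.log 2 ≤ (∫ ω, V ω ∂μ) + Fintype.card S * δ by
    refine le_of_forall_pos_le_add fun ε hε => ?_
    have hc : (0 : ℝ) < Fintype.card S := Nat.cast_pos.2 Fintype.card_pos
    have := hδ (ε / Fintype.card S) (by positivity)
    rwa [mul_div_cancel₀ _ hc.ne'] at this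
  intro δ hδ
  have haWY : Measurable fun ω => a (W ω) (Y ω) :=
    (measurable_uncurry_of_fintype ham).comp (hY.prodMk hW)
  have hbd : ∀ w, Integrable (fun ω => a w (Y ω) * -Real.log (a w (Y ω) + δ)) μ := by
    intro w
    refine Integrable.of_bound (C := |Real.log δ| + |Real.log (1 + δ)|) ?_ (ae_of_all _ fun ω => ?_)
    · have := (ham w).comp hY
      exact (this.mul (Real.measurable_log.comp (this.add_const δ)).neg).aestronglyMeasurable
    · rw [Real.norm_eq_abs, abs_mul, abs_of_nonneg (ha0 w _), abs_neg]
      exact (mul_le_of_le_one_left (abs_nonneg _) (ha1 w _)).trans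
        (abs_log_add_le (ha0 w _) (ha1 w _) hδ)
  have hlogint : Integrable (fun ω => -Real.log (a (W ω) (Y ω) + δ)) μ := by
    refine Integrable.of_bound (C := |Real.log δ| + |Real.log (1 + δ)|) ?_ (ae_of_all _ fun ω => ?_)
    · exact (Real.measurable_log.comp (haWY.add_const δ)).neg.aestronglyMeasurable
    · rw [Real.norm_eq_abs, abs_neg]
      exact abs_log_add_le (ha0 _ _) (ha1 _ _) hδ
  have step1 : condEntropy μ W Y * Real.log 2 ≤
      (∫ ω, -Real.log (a (W ω) (Y ω) + δ) ∂μ) + Fintype.card S * δ := by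
    rw [hent, hint (fun w y => -Real.log (a w y + δ))
      (fun w => (Real.measurable_log.comp ((ham w).add_const δ)).neg) hlogint,
      integral_finsetSum _ fun w _ => hbd w]
    have : (Fintype.card S : ℝ) * δ = ∑ _w : S, δ := by simp
    rw [this, ← Finset.sum_add_distrib]
    refine Finset.sum_le_sum fun w _ => ?_
    calc ∫ ω, Real.negMulLog (a w (Y ω)) ∂μ
        ≤ ∫ ω, (a w (Y ω) * -Real.log (a w (Y ω) + δ) + δ) ∂μ := by
          refine integral_mono_of_nonneg (ae_of_all _ fun ω =>
            Real.negMulLog_nonneg (ha0 w _) (ha1 w _)) ((hbd w).add (integrable_const _))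
            (ae_of_all _ fun ω => negMulLog_le_mul_neg_log_add (ha0 w _) hδ)
      _ = _ := by rw [integral_add (hbd w) (integrable_const _)]; simp
  have step2 : ∫ ω, (-Real.log (a (W ω) (Y ω) + δ) - V ω) ∂μ ≤ 0 := by
    have hle := h a ham ha0 hlint δ hδ
    have hpos : ∀ ω, 0 < (a (W ω) (Y ω) + δ)⁻¹ := fun ω =>
      inv_pos.2 (add_pos_of_nonneg_of_pos (ha0 _ _) hδ)
    simp_rw [← ENNReal.ofReal_mul (hpos _).le] at hle
    have hum : Measurable fun ω => (a (W ω) (Y ω) + δ)⁻¹ * Real.exp (-V ω) :=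
      (haWY.add_const δ).inv.mul hVm.neg.exp
    have hu0 : ∀ ω, 0 ≤ (a (W ω) (Y ω) + δ)⁻¹ * Real.exp (-V ω) := fun ω =>
      mul_nonneg (hpos ω).le (Real.exp_pos _).le
    have hui : Integrable (fun ω => (a (W ω) (Y ω) + δ)⁻¹ * Real.exp (-V ω)) μ := by
      refine ⟨hum.aestronglyMeasurable, ?_⟩
      rw [hasFiniteIntegral_iff_ofReal (ae_of_all _ hu0)]
      exact hle.trans_lt ENNReal.one_lt_top
    have hu1 : ∫ ω, (a (W ω) (Y ω) + δ)⁻¹ * Real.exp (-V ω) ∂μ ≤ 1 := by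
      rw [integral_eq_lintegral_of_nonneg_ae (ae_of_all _ hu0) hum.aestronglyMeasurable]
      exact ENNReal.toReal_mono ENNReal.one_ne_top hle
    calc ∫ ω, (-Real.log (a (W ω) (Y ω) + δ) - V ω) ∂μ
        ≤ ∫ ω, ((a (W ω) (Y ω) + δ)⁻¹ * Real.exp (-V ω) - 1) ∂μ := by
          refine integral_mono (hlogint.sub hV) (hui.sub (integrable_const _)) fun ω => ?_
          -- Here `log x ≤ x - 1`, applied to `e^{-V} / (a + δ)`, takes the place of Jensen's
          -- inequality.
          have := Real.log_le_sub_one_of_pos (mul_pos (hpos ω) (Real.exp_pos (-V ω)))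
          rw [Real.log_mul (hpos ω).ne' (Real.exp_pos _).ne', Real.log_exp, Real.log_inv] at this
          simpa [sub_eq_add_neg] using this
      _ = (∫ ω, (a (W ω) (Y ω) + δ)⁻¹ * Real.exp (-V ω) ∂μ) - 1 := by
          rw [integral_sub hui (integrable_const _)]; simp
      _ ≤ 0 := by linarith
  rw [integral_sub hlogint hV] at step2
  linarith

end Entropy

/-! ### The converse for a given noise correlation -/

section Converse

variable {Ω : Type*} [MeasurableSpace Ω] {S : Type*} [Fintype S] [Nonempty S] [MeasurableSpace S]
  [DiscreteMeasurableSpace S] {n : ℕ}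

/-- The law of a block of `n` independent standard complex Gaussians. -/
noncomputable abbrev blockGaussian (n : ℕ) : Measure (Fin n → ℂ) :=
  Measure.pi fun _ => complexGaussian

theorem condEntropy_le_integral_sub_log_add {μ : Measure Ω} [IsProbabilityMeasure μ] {W : Ω → S}
    (hW : Measurable W) {A B : Ω → Fin n → ℂ} (hA : Measurable A) (hB : Measurable B)
    {r : S → (Fin n → ℂ) → ℝ} (hr : ∀ w, Measurable (r w)) (hr0 : ∀ w y, 0 < r w y)
    (hr1 : ∀ y, ∑ w, r w y = 1) (ρ ν : ℂ) (c : Fin n → ℂ) {s σ : ℝ} (hs : 0 < s) (hσ : 0 < σ)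
    (hi : Integrable (fun ω : Ω × ((Fin n → ℂ) × (Fin n → ℂ)) =>
      -Real.log (r (W ω.1) (fun i => A ω.1 i + (ρ * ω.2.1 i + s * ω.2.2 i))) +
        ∑ i, logDensityRatio s σ (A ω.1 i + ρ * ω.2.1 i) (ν * (B ω.1 i + ω.2.1 i) + c i) (ω.2.2 i))
      (μ.prod ((blockGaussian n).prod (blockGaussian n)))) :
    condEntropy (μ.prod ((blockGaussian n).prod (blockGaussian n)))
        (fun ω => W ω.1) (fun ω => B ω.1 + ω.2.1) * Real.log 2 ≤
      ∫ ω : Ω × ((Fin n → ℂ) × (Fin n → ℂ)),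
        (-Real.log (r (W ω.1) (fun i => A ω.1 i + (ρ * ω.2.1 i + s * ω.2.2 i))) +
        ∑ i, logDensityRatio s σ (A ω.1 i + ρ * ω.2.1 i) (ν * (B ω.1 i + ω.2.1 i) + c i) (ω.2.2 i))
        ∂(μ.prod ((blockGaussian n).prod (blockGaussian n))) := by
  have hrm := measurable_uncurry_of_fintype hr
  have hr' : Measurable fun ω : Ω × ((Fin n → ℂ) × (Fin n → ℂ)) =>
      r (W ω.1) (fun i => A ω.1 i + (ρ * ω.2.1 i + s * ω.2.2 i)) :=
    hrm.comp (Measurable.prodMk (by fun_prop) (hW.comp measurable_fst))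
  have hLm : Measurable fun ω : Ω × ((Fin n → ℂ) × (Fin n → ℂ)) =>
      ∑ i, logDensityRatio s σ (A ω.1 i + ρ * ω.2.1 i)
        (ν * (B ω.1 i + ω.2.1 i) + c i) (ω.2.2 i) := by
    unfold logDensityRatio; fun_prop
  have hVm := (Real.measurable_log.comp hr').neg.add hLm
  refine condEntropy_le_of_forall_test (by fun_prop) (by fun_prop) hi hVm ?_
  intro a ham ha0 hpost δ hδ
  -- What is left of the test integrand once `u` is integrated out: the reference Gaussian is
  -- centred at `ν y + c`, so only `W` and `Y` remain, and the posterior identity applies.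
  let G : S → (Fin n → ℂ) → ℝ≥0∞ := fun w y => ENNReal.ofReal ((a w y + δ)⁻¹) *
    ∫⁻ u, ENNReal.ofReal (r w fun i => (ν * y i + c i) + σ * u i) ∂blockGaussian n
  have hGm : ∀ w, Measurable (G w) := by
    intro w
    refine Measurable.mul (by have := ham w; fun_prop) (Measurable.lintegral_prod_right ?_)
    exact ((hr w).comp (by fun_prop)).ennreal_ofReal
  have hamW : Measurable fun ω : Ω × ((Fin n → ℂ) × (Fin n → ℂ)) =>
      a (W ω.1) (B ω.1 + ω.2.1) :=
    (measurable_uncurry_of_fintype ham).comp (Measurable.prodMk (by fun_prop) (by fun_prop))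
  have hGmW : Measurable fun ω : Ω × ((Fin n → ℂ) × (Fin n → ℂ)) =>
      G (W ω.1) (B ω.1 + ω.2.1) :=
    (measurable_uncurry_of_fintype hGm).comp (Measurable.prodMk (by fun_prop) (by fun_prop))
  have hchange : ∫⁻ ω, ENNReal.ofReal ((a (W ω.1) (B ω.1 + ω.2.1) + δ)⁻¹) * ENNReal.ofReal
        (Real.exp (-(-Real.log (r (W ω.1) (fun i => A ω.1 i + (ρ * ω.2.1 i + s * ω.2.2 i))) +
          ∑ i, logDensityRatio s σ (A ω.1 i + ρ * ω.2.1 i)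
            (ν * (B ω.1 i + ω.2.1 i) + c i) (ω.2.2 i))))
        ∂(μ.prod ((blockGaussian n).prod (blockGaussian n))) =
      ∫⁻ ω, G (W ω.1) (B ω.1 + ω.2.1)
        ∂(μ.prod ((blockGaussian n).prod (blockGaussian n))) := by
    rw [lintegral_prod _ (Measurable.aemeasurable (by
      exact (hamW.add_const δ).inv.ennreal_ofReal.mul (hVm.neg.exp).ennreal_ofReal)),
      lintegral_prod _ hGmW.aemeasurable]
    refine lintegral_congr fun ω => ?_
    rw [lintegral_prod _ (Measurable.aemeasurable (by
      exact ((hamW.add_const δ).inv.ennreal_ofReal.mul (hVm.neg.exp).ennreal_ofReal).comp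
        measurable_prodMk_left))]
    dsimp only
    rw [lintegral_prod (fun p : (Fin n → ℂ) × (Fin n → ℂ) => G (W ω) (B ω + p.1))
      (hGmW.comp measurable_prodMk_left).aemeasurable]
    refine lintegral_congr fun z => ?_
    simp only [lintegral_const, measure_univ, mul_one]
    have hLz : Measurable fun u : Fin n → ℂ => ∑ i, logDensityRatio s σ (A ω i + ρ * z i)
        (ν * (B ω i + z i) + c i) (u i) := by
      unfold logDensityRatio; fun_prop
    have hrz : Measurable fun u : Fin n → ℂ =>
        r (W ω) (fun i => A ω i + (ρ * z i + s * u i)) := (hr _).comp (by fun_prop)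
    have hEz : Measurable fun u : Fin n → ℂ => ENNReal.ofReal
        (Real.exp (-(-Real.log (r (W ω) (fun i => A ω i + (ρ * z i + s * u i))) +
          ∑ i, logDensityRatio s σ (A ω i + ρ * z i) (ν * (B ω i + z i) + c i) (u i)))) := by
      fun_prop
    rw [lintegral_const_mul _ hEz]
    simp only [G]
    congr 1
    have hcm := lintegral_pi_exp_neg_sum_logDensityRatio hs hσ (fun i => A ω i + ρ * z i)
      (fun i => ν * (B ω i + z i) + c i) (hr (W ω)).ennreal_ofReal
    simp only [Pi.add_apply]
    rw [← hcm]
    refine lintegral_congr fun u => ?_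
    rw [neg_add, neg_neg, Real.exp_add, Real.exp_log (hr0 _ _),
      ENNReal.ofReal_mul (hr0 _ _).le]
    simp only [add_assoc]
  rw [hchange, hpost G hGm]
  calc _ ≤ ∫⁻ _ω : Ω × ((Fin n → ℂ) × (Fin n → ℂ)), 1
        ∂(μ.prod ((blockGaussian n).prod (blockGaussian n))) := by
        refine lintegral_mono fun ω => ?_
        set y := B ω.1 + ω.2.1
        calc ∑ w, ENNReal.ofReal (a w y) * G w y
            ≤ ∑ w, ∫⁻ u, ENNReal.ofReal (r w fun i => (ν * y i + c i) + σ * u i)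
                ∂blockGaussian n := by
              refine Finset.sum_le_sum fun w _ => ?_
              simp only [G]
              -- The posterior weight meets its own regularized inverse: `a / (a + δ) ≤ 1`. The
              -- remaining sum over `w` is one because `r` is a probability vector.
              rw [← mul_assoc, ← ENNReal.ofReal_mul (ha0 w y)]
              refine mul_le_of_le_one_left (zero_le) (ENNReal.ofReal_le_one.2 ?_)
              have := ha0 w y
              rw [← div_eq_mul_inv, div_le_one (by linarith)]
              linarith
          _ = ∫⁻ u, ∑ w, ENNReal.ofReal (r w fun i => (ν * y i + c i) + σ * u i)
                ∂blockGaussian n := by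
              rw [lintegral_finsetSum]
              intro w _
              exact ((hr w).comp (by fun_prop)).ennreal_ofReal
          _ = 1 := by
              simp_rw [← ENNReal.ofReal_sum_of_nonneg (fun w _ => (hr0 w _).le), hr1]
              simp
    _ = 1 := by simp

end Converse

/-! ### Second moments of signal plus noise -/

section SecondMoments

variable {Ω Ω' : Type*} [MeasurableSpace Ω] [MeasurableSpace Ω']

theorem memLp_two_add_prod {μ : Measure Ω} [IsProbabilityMeasure μ] {ν : Measure Ω'}
    [IsProbabilityMeasure ν] {X : Ω → ℂ} {Z : Ω' → ℂ} (hX : MemLp X 2 μ) (hZ : MemLp Z 2 ν) :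
    MemLp (fun p : Ω × Ω' => X p.1 + Z p.2) 2 (μ.prod ν) :=
  (hX.comp_measurePreserving measurePreserving_fst).add
    (hZ.comp_measurePreserving measurePreserving_snd)

/-- Independence together with the zero mean of `Z` kills the cross term. -/
theorem integral_norm_sq_add_prod {μ : Measure Ω} [IsProbabilityMeasure μ] {ν : Measure Ω'}
    [IsProbabilityMeasure ν] {X : Ω → ℂ} {Z : Ω' → ℂ} (hX : MemLp X 2 μ) (hZ : MemLp Z 2 ν)
    (h0 : ∫ z, Z z ∂ν = 0) :
    ∫ p, ‖X p.1 + Z p.2‖ ^ 2 ∂(μ.prod ν) = (∫ x, ‖X x‖ ^ 2 ∂μ) + ∫ z, ‖Z z‖ ^ 2 ∂ν := by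
  have hX1 := hX.integrable one_le_two
  have hZ1 : Integrable (fun z => star (Z z)) ν := by
    simpa using (Complex.conjCLE.toContinuousLinearMap.integrable_comp (hZ.integrable one_le_two))
  have hXX : Integrable (fun p : Ω × Ω' => ‖X p.1‖ ^ 2) (μ.prod ν) :=
    (hX.integrable_norm_pow two_ne_zero).comp_fst ν
  have hZZ : Integrable (fun p : Ω × Ω' => ‖Z p.2‖ ^ 2) (μ.prod ν) :=
    (hZ.integrable_norm_pow two_ne_zero).comp_snd μ
  have hXZ : Integrable (fun p : Ω × Ω' => X p.1 * star (Z p.2)) (μ.prod ν) := hX1.mul_prod hZ1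
  have hXZ0 : ∫ p, X p.1 * star (Z p.2) ∂(μ.prod ν) = 0 := by
    rw [integral_prod_mul (μ := μ) (ν := ν) X (fun z => star (Z z))]
    have : ∫ z, star (Z z) ∂ν = star (∫ z, Z z ∂ν) := integral_conj
    rw [this, h0, star_zero, mul_zero]
  have hexp : ∀ p : Ω × Ω', ‖X p.1 + Z p.2‖ ^ 2 =
      ‖X p.1‖ ^ 2 + ‖Z p.2‖ ^ 2 + 2 * (X p.1 * star (Z p.2)).re := by
    intro p
    simp only [← Complex.normSq_eq_norm_sq]
    exact Complex.normSq_add _ _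
  have hre : Integrable (fun p : Ω × Ω' => (X p.1 * star (Z p.2)).re) (μ.prod ν) := hXZ.re
  have hre0 : ∫ p, (X p.1 * star (Z p.2)).re ∂(μ.prod ν) = 0 := by
    have := integral_re hXZ
    simp only [RCLike.re_eq_complex_re] at this
    rw [this, hXZ0, Complex.zero_re]
  have hsum : Integrable (fun p : Ω × Ω' => ‖X p.1‖ ^ 2 + ‖Z p.2‖ ^ 2) (μ.prod ν) := hXX.add hZZ
  simp_rw [hexp]
  rw [integral_add hsum (hre.const_mul 2), integral_add hXX hZZ, integral_const_mul, hre0,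
    integral_fun_fst (fun x => ‖X x‖ ^ 2), integral_fun_snd (fun z => ‖Z z‖ ^ 2)]
  simp

theorem memLp_eval_blockGaussian {n : ℕ} (i : Fin n) :
    MemLp (fun z : Fin n → ℂ => z i) 2 (blockGaussian n) :=
  memLp_id_complexGaussian.comp_measurePreserving
    (measurePreserving_eval (fun _ : Fin n => complexGaussian) i)

theorem integral_eval_blockGaussian {n : ℕ} (i : Fin n) :
    ∫ z, z i ∂blockGaussian n = 0 := by
  rw [integral_comp_eval (μ := fun _ : Fin n => complexGaussian) (f := fun z : ℂ => z)
    (by fun_prop), integral_id_complexGaussian]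

theorem integral_norm_sq_eval_blockGaussian {n : ℕ} (i : Fin n) :
    ∫ z, ‖z i‖ ^ 2 ∂blockGaussian n = 1 := by
  rw [integral_comp_eval (μ := fun _ : Fin n => complexGaussian) (f := fun z : ℂ => ‖z‖ ^ 2)
    (by fun_prop), integral_norm_sq_complexGaussian]

theorem integral_norm_sq_add_noise {μ : Measure Ω} [IsProbabilityMeasure μ] {X : Ω → ℂ}
    (hX : MemLp X 2 μ) {n : ℕ} (i : Fin n) (a b : ℂ) :
    MemLp (fun p : Ω × ((Fin n → ℂ) × (Fin n → ℂ)) => X p.1 + (a * p.2.1 i + b * p.2.2 i)) 2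
        (μ.prod ((blockGaussian n).prod (blockGaussian n))) ∧
      ∫ p : Ω × ((Fin n → ℂ) × (Fin n → ℂ)), ‖X p.1 + (a * p.2.1 i + b * p.2.2 i)‖ ^ 2
        ∂(μ.prod ((blockGaussian n).prod (blockGaussian n))) =
      (∫ x, ‖X x‖ ^ 2 ∂μ) + (‖a‖ ^ 2 + ‖b‖ ^ 2) := by
  have hz := fun c : ℂ => (memLp_eval_blockGaussian i).const_mul c
  have h0 : ∀ c : ℂ, ∫ z : Fin n → ℂ, c * z i ∂blockGaussian n = 0 := fun c => by
    rw [integral_const_mul, integral_eval_blockGaussian, mul_zero]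
  have h1 : ∀ c : ℂ, ∫ z : Fin n → ℂ, ‖c * z i‖ ^ 2 ∂blockGaussian n = ‖c‖ ^ 2 := fun c => by
    simp_rw [norm_mul, mul_pow]
    rw [integral_const_mul, integral_norm_sq_eval_blockGaussian, mul_one]
  have hZ := memLp_two_add_prod (hz a) (hz b)
  have hZ0 : ∫ p : (Fin n → ℂ) × (Fin n → ℂ), (a * p.1 i + b * p.2 i)
      ∂((blockGaussian n).prod (blockGaussian n)) = 0 := by
    rw [integral_add (((hz a).integrable one_le_two).comp_fst _)
      (((hz b).integrable one_le_two).comp_snd _), integral_fun_fst (fun z : Fin n → ℂ => a * z i),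
      integral_fun_snd (fun z : Fin n → ℂ => b * z i), h0, h0]
    simp
  refine ⟨memLp_two_add_prod hX hZ, ?_⟩
  rw [integral_norm_sq_add_prod hX hZ hZ0, integral_norm_sq_add_prod (hz a) (hz b) (h0 b), h1, h1]

/-- The difference of the two centres, with `s u` added, is the estimation error `A - ν B - c` plus
the independent centred noise `(ρ - ν) z + s u`, so its mean square splits into the two displayed
parts. -/
theorem integral_sum_logDensityRatio {μ : Measure Ω} [IsProbabilityMeasure μ] {n : ℕ}
    {A B : Ω → Fin n → ℂ} (hA : ∀ i, MemLp (fun ω => A ω i) 2 μ)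
    (hB : ∀ i, MemLp (fun ω => B ω i) 2 μ) (ρ ν : ℂ) (c : Fin n → ℂ) (s σ : ℝ) :
    Integrable (fun ω : Ω × ((Fin n → ℂ) × (Fin n → ℂ)) => ∑ i, logDensityRatio s σ
        (A ω.1 i + ρ * ω.2.1 i) (ν * (B ω.1 i + ω.2.1 i) + c i) (ω.2.2 i))
      (μ.prod ((blockGaussian n).prod (blockGaussian n))) ∧
    ∫ ω : Ω × ((Fin n → ℂ) × (Fin n → ℂ)), (∑ i, logDensityRatio s σ
        (A ω.1 i + ρ * ω.2.1 i) (ν * (B ω.1 i + ω.2.1 i) + c i) (ω.2.2 i))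
      ∂(μ.prod ((blockGaussian n).prod (blockGaussian n))) =
      n * Real.log (σ ^ 2 / s ^ 2) - n +
        ((∑ i, ∫ ω, ‖A ω i - ν * B ω i - c i‖ ^ 2 ∂μ) + n * (‖ρ - ν‖ ^ 2 + s ^ 2)) / σ ^ 2 := by
  have hD : ∀ i, MemLp (fun ω => A ω i - ν * B ω i - c i) 2 μ := fun i =>
    ((hA i).sub ((hB i).const_mul ν)).sub (memLp_const (c i))
  have hrew : ∀ (i : Fin n) (ω : Ω × ((Fin n → ℂ) × (Fin n → ℂ))), logDensityRatio s σ
        (A ω.1 i + ρ * ω.2.1 i) (ν * (B ω.1 i + ω.2.1 i) + c i) (ω.2.2 i) =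
      Real.log (σ ^ 2 / s ^ 2) - ‖ω.2.2 i‖ ^ 2 + ‖(A ω.1 i - ν * B ω.1 i - c i) +
        ((ρ - ν) * ω.2.1 i + (s : ℂ) * ω.2.2 i)‖ ^ 2 / σ ^ 2 := by
    intro i ω
    unfold logDensityRatio
    congr 4
    ring
  have hz : ∀ i : Fin n, Integrable (fun ω : Ω × ((Fin n → ℂ) × (Fin n → ℂ)) => ‖ω.2.2 i‖ ^ 2)
      (μ.prod ((blockGaussian n).prod (blockGaussian n))) := fun i =>
    (((memLp_eval_blockGaussian i).integrable_norm_pow two_ne_zero).comp_snd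
      (blockGaussian n)).comp_snd μ
  have hz1 : ∀ i : Fin n, ∫ ω : Ω × ((Fin n → ℂ) × (Fin n → ℂ)), ‖ω.2.2 i‖ ^ 2
      ∂(μ.prod ((blockGaussian n).prod (blockGaussian n))) = 1 := fun i => by
    rw [integral_fun_snd (fun p : (Fin n → ℂ) × (Fin n → ℂ) => ‖p.2 i‖ ^ 2),
      integral_fun_snd (fun z : Fin n → ℂ => ‖z i‖ ^ 2), integral_norm_sq_eval_blockGaussian]
    simp
  have hN := fun i => integral_norm_sq_add_noise (hD i) i (ρ - ν) (s : ℂ)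
  have hNi := fun i => ((hN i).1.integrable_norm_pow two_ne_zero).div_const (σ ^ 2)
  have hi : ∀ i : Fin n, Integrable (fun ω : Ω × ((Fin n → ℂ) × (Fin n → ℂ)) =>
      logDensityRatio s σ (A ω.1 i + ρ * ω.2.1 i) (ν * (B ω.1 i + ω.2.1 i) + c i) (ω.2.2 i))
      (μ.prod ((blockGaussian n).prod (blockGaussian n))) := by
    intro i
    simp_rw [hrew i]
    exact ((integrable_const _).sub (hz i)).add (hNi i)
  refine ⟨integrable_finsetSum _ fun i _ => hi i, ?_⟩
  rw [integral_finsetSum _ fun i _ => hi i]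
  have : ∀ i : Fin n, ∫ ω : Ω × ((Fin n → ℂ) × (Fin n → ℂ)), logDensityRatio s σ
        (A ω.1 i + ρ * ω.2.1 i) (ν * (B ω.1 i + ω.2.1 i) + c i) (ω.2.2 i)
      ∂(μ.prod ((blockGaussian n).prod (blockGaussian n))) =
      (Real.log (σ ^ 2 / s ^ 2) - 1) +
        ((∫ ω, ‖A ω i - ν * B ω i - c i‖ ^ 2 ∂μ) + (‖ρ - ν‖ ^ 2 + s ^ 2)) / σ ^ 2 := by
    intro i
    have hsub : Integrable (fun ω : Ω × ((Fin n → ℂ) × (Fin n → ℂ)) =>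
        Real.log (σ ^ 2 / s ^ 2) - ‖ω.2.2 i‖ ^ 2)
        (μ.prod ((blockGaussian n).prod (blockGaussian n))) := (integrable_const _).sub (hz i)
    simp_rw [hrew i]
    rw [integral_add hsub (hNi i),
      integral_sub (integrable_const _) (hz i), hz1, integral_div, (hN i).2, Complex.norm_real,
      Real.norm_eq_abs, sq_abs]
    simp
  simp_rw [this]
  rw [Finset.sum_add_distrib, ← Finset.sum_div, Finset.sum_add_distrib]
  simp
  ring

end SecondMoments

/-! ### The converse bound for a decoder -/

section Converse

variable {Ω : Type*} [MeasurableSpace Ω] {S : Type*} [Fintype S] [Nonempty S] [MeasurableSpace S]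
  [DiscreteMeasurableSpace S] {n : ℕ}

/-- The converse for one user, in terms of the second moment of the error of an affine estimate
`ν B + c` of the signal `A`, the error probability of a decoder of the message from `A + z`, and
an auxiliary correlation `ρ` of the two noises. -/
theorem condEntropy_le_of_decoder {μ : Measure Ω} [IsProbabilityMeasure μ] {W : Ω → S}
    (hW : Measurable W) {A B : Ω → Fin n → ℂ} (hA : Measurable A) (hB : Measurable B)
    (hA2 : ∀ i, MemLp (fun ω => A ω i) 2 μ) (hB2 : ∀ i, MemLp (fun ω => B ω i) 2 μ)
    {dec : (Fin n → ℂ) → S} (hdec : Measurable dec) {η : ℝ} (hη0 : 0 < η) (hη1 : η < 1)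
    {ρ : ℂ} (hρ : ‖ρ‖ < 1) (ν : ℂ) (c : Fin n → ℂ) (hn : 1 ≤ n) :
    condEntropy (μ.prod (blockGaussian n)) (fun ω => W ω.1) (fun ω => B ω.1 + ω.2) * Real.log 2 ≤
      -Real.log (1 - η) + (μ.prod (blockGaussian n)).real {ω | dec (A ω.1 + ω.2) ≠ W ω.1} *
        (Real.log (Fintype.card S) - Real.log η) +
      n * Real.log (((1 / n) * ∑ i, ∫ ω, ‖A ω i - ν * B ω i - c i‖ ^ 2 ∂μ +
        (‖ρ - ν‖ ^ 2 + (1 - ‖ρ‖ ^ 2))) / (1 - ‖ρ‖ ^ 2)) := by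
  classical
  have hn0 : (0 : ℝ) < n := by exact_mod_cast hn
  have hs2 : 0 < 1 - ‖ρ‖ ^ 2 := by nlinarith [norm_nonneg ρ]
  set s := Real.sqrt (1 - ‖ρ‖ ^ 2) with hs_def
  have hs : 0 < s := Real.sqrt_pos.2 hs2
  have hss : s ^ 2 = 1 - ‖ρ‖ ^ 2 := Real.sq_sqrt hs2.le
  set Q := ∑ i, ∫ ω, ‖A ω i - ν * B ω i - c i‖ ^ 2 ∂μ with hQ
  have hQ0 : 0 ≤ Q := Finset.sum_nonneg fun i _ => integral_nonneg fun ω => by positivity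
  have hV : 0 < (1 / n) * Q + (‖ρ - ν‖ ^ 2 + (1 - ‖ρ‖ ^ 2)) := by positivity
  -- The reference variance is the actual mean square error per channel use; it makes the quadratic
  -- terms of the log-density ratio cancel on average.
  set σ := Real.sqrt ((1 / n) * Q + (‖ρ - ν‖ ^ 2 + (1 - ‖ρ‖ ^ 2))) with hσ_def
  have hσ : 0 < σ := Real.sqrt_pos.2 hV
  have hσσ : σ ^ 2 = (1 / n) * Q + (‖ρ - ν‖ ^ 2 + (1 - ‖ρ‖ ^ 2)) := Real.sq_sqrt hV.le
  have hM : (1 : ℝ) ≤ Fintype.card S := by exact_mod_cast Fintype.card_pos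
  have hηM : 0 < η / Fintype.card S := by positivity
  -- The decoder's decision mixed with the uniform law. The mixture keeps `-log r` finite when the
  -- decoder errs, and its mean is then a form of Fano's bound.
  let r : S → (Fin n → ℂ) → ℝ := fun w y =>
    (1 - η) * (if dec y = w then 1 else 0) + η / Fintype.card S
  have hr : ∀ w, Measurable (r w) := by
    intro w
    have : Measurable fun y => if dec y = w then (1 : ℝ) else 0 :=
      Measurable.ite (hdec (measurableSet_singleton w)) measurable_const measurable_const
    exact (this.const_mul _).add_const _
  have hrl : ∀ w y, η / Fintype.card S ≤ r w y := by
    intro w y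
    simp only [r]
    split_ifs <;> linarith
  have hr0 : ∀ w y, 0 < r w y := fun w y => hηM.trans_le (hrl w y)
  have hr1 : ∀ y, ∑ w, r w y = 1 := by
    intro y
    simp only [r]
    rw [Finset.sum_add_distrib, ← Finset.mul_sum, Finset.sum_ite_eq]
    simp
    field_simp
    ring
  have hlogη : -Real.log (1 - η) ≥ 0 :=
    neg_nonneg.2 (Real.log_nonpos (by linarith) (by linarith))
  have hlogM : 0 ≤ Real.log (Fintype.card S) - Real.log η := by
    have h1 := Real.log_nonneg hM
    have h2 := Real.log_nonpos hη0.le hη1.le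
    linarith
  have hrle : ∀ w y, -Real.log (r w y) ≤ -Real.log (1 - η) +
      (if dec y ≠ w then 1 else 0) * (Real.log (Fintype.card S) - Real.log η) := by
    intro w y
    by_cases h : dec y = w
    · have : Real.log (1 - η) ≤ Real.log (r w y) :=
        Real.log_le_log (by linarith) (by simp only [r, h, if_true]; linarith)
      simp [h, this]
    · have : Real.log (η / Fintype.card S) ≤ Real.log (r w y) := Real.log_le_log hηM (hrl w y)
      rw [Real.log_div hη0.ne' (by positivity)] at this
      simp only [ne_eq, h, not_false_eq_true, if_true, one_mul]
      linarith
  have hrge : ∀ w y, 0 ≤ -Real.log (r w y) := by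
    intro w y
    refine neg_nonneg.2 (Real.log_nonpos (hr0 w y).le ?_)
    rw [← hr1 y]
    exact Finset.single_le_sum (f := fun w => r w y) (fun i _ => (hr0 i y).le) (Finset.mem_univ w)
  set P := μ.prod ((blockGaussian n).prod (blockGaussian n)) with hP
  -- The coupled output has the same joint law with the message as the original one, so the decoder
  -- keeps its error probability.
  have hmp1 : MeasurePreserving (Prod.map (id : Ω → Ω)
      (fun (p : (Fin n → ℂ) × (Fin n → ℂ)) i => ρ * p.1 i + s * p.2 i)) P
      (μ.prod (blockGaussian n)) :=
    (MeasurePreserving.id μ).prod ⟨by fun_prop, map_combination_pi_complexGaussian n (by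
      rw [hss]; ring)⟩
  have hmp2 : MeasurePreserving (Prod.map (id : Ω → Ω)
      (Prod.fst : (Fin n → ℂ) × (Fin n → ℂ) → (Fin n → ℂ))) P (μ.prod (blockGaussian n)) :=
    (MeasurePreserving.id μ).prod measurePreserving_fst
  have hent : condEntropy (μ.prod (blockGaussian n)) (fun ω => W ω.1) (fun ω => B ω.1 + ω.2) =
      condEntropy P (fun ω => W ω.1) (fun ω => B ω.1 + ω.2.1) := by
    refine condEntropy_congr_law (by fun_prop) (by fun_prop) (by fun_prop) (by fun_prop) ?_
    rw [← hmp2.map_eq, Measure.map_map (by fun_prop) hmp2.measurable]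
    rfl
  obtain ⟨hLi, hLint⟩ := integral_sum_logDensityRatio hA2 hB2 ρ ν c s σ
  have hrm : Measurable fun ω : Ω × ((Fin n → ℂ) × (Fin n → ℂ)) =>
      r (W ω.1) (fun i => A ω.1 i + (ρ * ω.2.1 i + s * ω.2.2 i)) :=
    (measurable_uncurry_of_fintype hr).comp
      (Measurable.prodMk (by fun_prop) (hW.comp measurable_fst))
  have hset : MeasurableSet {ω : Ω × (Fin n → ℂ) | dec (A ω.1 + ω.2) ≠ W ω.1} :=
    (measurableSet_eq_fun (f := fun ω : Ω × (Fin n → ℂ) => dec (A ω.1 + ω.2))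
      (g := fun ω => W ω.1) (hdec.comp (by fun_prop)) (by fun_prop)).compl
  have hindi : Integrable ({ω : Ω × (Fin n → ℂ) | dec (A ω.1 + ω.2) ≠ W ω.1}.indicator
      (1 : Ω × (Fin n → ℂ) → ℝ)) (μ.prod (blockGaussian n)) :=
    (integrable_const (1 : ℝ)).indicator hset
  have hindP := hmp1.integrable_comp_of_integrable hindi
  have hboundi : Integrable (fun ω : Ω × ((Fin n → ℂ) × (Fin n → ℂ)) => -Real.log (1 - η) +
      (if dec (fun i => A ω.1 i + (ρ * ω.2.1 i + s * ω.2.2 i)) ≠ W ω.1 then 1 else 0) *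
        (Real.log (Fintype.card S) - Real.log η)) P := by
    refine (integrable_const _).add (Integrable.mul_const (hindP.congr (ae_of_all _ fun ω => ?_)) _)
    simp only [Function.comp, Set.indicator, Set.mem_ofPred_eq, Prod.map, id, Pi.one_apply]
    rfl
  have hri : Integrable (fun ω : Ω × ((Fin n → ℂ) × (Fin n → ℂ)) =>
      -Real.log (r (W ω.1) (fun i => A ω.1 i + (ρ * ω.2.1 i + s * ω.2.2 i)))) P := by
    refine hboundi.mono' (Real.measurable_log.comp hrm).neg.aestronglyMeasurable
      (ae_of_all _ fun ω => ?_)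
    rw [Real.norm_eq_abs, abs_of_nonneg (hrge _ _)]
    exact hrle _ _
  have hmain := condEntropy_le_integral_sub_log_add hW hA hB hr hr0 hr1 ρ ν c hs hσ (hri.add hLi)
  rw [integral_add hri hLi, hLint] at hmain
  have hrint : ∫ ω : Ω × ((Fin n → ℂ) × (Fin n → ℂ)),
      -Real.log (r (W ω.1) (fun i => A ω.1 i + (ρ * ω.2.1 i + s * ω.2.2 i))) ∂P ≤
      -Real.log (1 - η) + (μ.prod (blockGaussian n)).real {ω | dec (A ω.1 + ω.2) ≠ W ω.1} *
        (Real.log (Fintype.card S) - Real.log η) := by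
    refine (integral_mono hri hboundi fun ω => hrle _ _).trans_eq ?_
    have hcomp : ∫ ω : Ω × ((Fin n → ℂ) × (Fin n → ℂ)),
        (if dec (fun i => A ω.1 i + (ρ * ω.2.1 i + s * ω.2.2 i)) ≠ W ω.1 then (1 : ℝ) else 0) ∂P =
        (μ.prod (blockGaussian n)).real {ω | dec (A ω.1 + ω.2) ≠ W ω.1} := by
      rw [← integral_indicator_one hset, ← hmp1.map_eq,
        integral_map hmp1.measurable.aemeasurable (by
          rw [hmp1.map_eq]; exact hindi.aestronglyMeasurable)]
      refine integral_congr_ae (ae_of_all _ fun ω => ?_)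
      simp only [Set.indicator, Set.mem_ofPred_eq, Prod.map, id, Pi.one_apply]
      rfl
    have hi' : Integrable (fun ω : Ω × ((Fin n → ℂ) × (Fin n → ℂ)) =>
        (if dec (fun i => A ω.1 i + (ρ * ω.2.1 i + s * ω.2.2 i)) ≠ W ω.1 then (1 : ℝ) else 0)) P :=
      hindP.congr (ae_of_all _ fun ω => by
        simp only [Function.comp, Set.indicator, Set.mem_ofPred_eq, Prod.map, id, Pi.one_apply]
        rfl)
    rw [integral_add (integrable_const _) (hi'.mul_const _), integral_mul_const, hcomp]
    simp
  have hvar : (Q + n * (‖ρ - ν‖ ^ 2 + s ^ 2)) / σ ^ 2 = n := by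
    rw [div_eq_iff (by positivity), hσσ, hss]
    field_simp
  rw [hent]
  rw [hvar, hσσ, hss] at hmain
  linarith

end Converse

/-! ### Codes -/

section Codes

variable {t n M₁ M₂ : ℕ}

theorem hdot_sub_right (v x y : Fin t → ℂ) : hdot v (x - y) = hdot v x - hdot v y := by
  simp [hdot, dotProduct_sub]

theorem hdot_sub_smul_left (v w x : Fin t → ℂ) (ν : ℂ) :
    hdot (v - ν • w) x = hdot v x - star ν * hdot w x := by
  simp [hdot, sub_dotProduct, smul_dotProduct]

theorem measurable_hdot (v : Fin t → ℂ) : Measurable (hdot v) := by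
  unfold hdot dotProduct; fun_prop

/-- Identifies `ψ` as the mean square of the noise left after estimation, and shows why conjugates
of `ρ` and `ν` enter the converse. -/
theorem psi_eq (ν ρ : ℂ) : psi ν ρ = ‖star ρ - star ν‖ ^ 2 + (1 - ‖ρ‖ ^ 2) := by
  rw [← star_sub, norm_star]
  simp only [psi, ← Complex.normSq_eq_norm_sq, Complex.normSq_apply]
  simp
  ring

namespace SecretCode

/-- The joint law of the messages and the transmitted block. -/
noncomputable def inputLaw (c : SecretCode t n M₁ M₂) :
    Measure ((Fin M₁ × Fin M₂) × (Fin n → Fin t → ℂ)) :=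
  (uniformOn (Set.univ : Set (Fin M₁ × Fin M₂))) ⊗ₘ c.enc

instance [NeZero M₁] [NeZero M₂] (c : SecretCode t n M₁ M₂) :
    IsProbabilityMeasure c.inputLaw := by
  have := c.markov
  unfold inputLaw
  infer_instance

instance : IsProbabilityMeasure (noiseLaw n) := by unfold noiseLaw; infer_instance

instance [NeZero M₁] [NeZero M₂] (c : SecretCode t n M₁ M₂) : IsProbabilityMeasure c.law :=
  inferInstanceAs (IsProbabilityMeasure (c.inputLaw.prod (noiseLaw n)))

theorem measurePreserving_noise₁ :
    MeasurePreserving (fun (z : Fin n → ℂ × ℂ) i => (z i).1) (noiseLaw n) (blockGaussian n) :=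
  measurePreserving_fst.comp (measurePreserving_arrowProdEquivProdArrow ℂ ℂ (Fin n)
    (fun _ => complexGaussian) (fun _ => complexGaussian))

theorem measurePreserving_noise₂ :
    MeasurePreserving (fun (z : Fin n → ℂ × ℂ) i => (z i).2) (noiseLaw n) (blockGaussian n) :=
  measurePreserving_snd.comp (measurePreserving_arrowProdEquivProdArrow ℂ ℂ (Fin n)
    (fun _ => complexGaussian) (fun _ => complexGaussian))

variable [NeZero M₁] [NeZero M₂] (c : SecretCode t n M₁ M₂)

/-! ### The input covariance matrix as a quadratic form -/

theorem memLp_centered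
    (hc : ∀ i a, MemLp (fun ω : Sample t n M₁ M₂ => input ω i a) 2 c.law) (i : Fin n) (a : Fin t) :
    MemLp (fun ω : Sample t n M₁ M₂ => input ω i a - c.inputMean i a) 2 c.law :=
  (hc i a).sub (memLp_const _)

/-- Stated in `ℂ` so that it gives both the value of `quadForm` and, being a nonnegative real,
positive semidefiniteness. -/
theorem dotProduct_inputCov_mulVec
    (hc : ∀ i a, MemLp (fun ω : Sample t n M₁ M₂ => input ω i a) 2 c.law) (v : Fin t → ℂ) :
    star v ⬝ᵥ c.inputCov.mulVec v =
      ((1 / n * ∑ i, ∫ ω, ‖hdot v (input ω i - c.inputMean i)‖ ^ 2 ∂c.law : ℝ) : ℂ) := by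
  have hd := c.memLp_centered hc
  have hds : ∀ i a, MemLp (fun ω : Sample t n M₁ M₂ => star (input ω i a - c.inputMean i a)) 2
      c.law := fun i a => (hd i a).star
  have hi : ∀ i a b, Integrable (fun ω : Sample t n M₁ M₂ =>
      (input ω i a - c.inputMean i a) * star (input ω i b - c.inputMean i b)) c.law :=
    fun i a b => (hd i a).integrable_mul (hds i b)
  have hpt : ∀ (i : Fin n) (ω : Sample t n M₁ M₂),
      ((‖hdot v (input ω i - c.inputMean i)‖ ^ 2 : ℝ) : ℂ) = ∑ a, ∑ b, star (v a) * v b *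
        ((input ω i a - c.inputMean i a) * star (input ω i b - c.inputMean i b)) := by
    intro i ω
    rw [← Complex.normSq_eq_norm_sq, ← Complex.mul_conj]
    simp only [hdot, dotProduct, map_sum, Finset.sum_mul_sum, Pi.sub_apply, Pi.star_apply]
    refine Finset.sum_congr rfl fun a _ => Finset.sum_congr rfl fun b _ => ?_
    simp
    ring
  have hint : ∀ i : Fin n, ((∫ ω, ‖hdot v (input ω i - c.inputMean i)‖ ^ 2 ∂c.law : ℝ) : ℂ) =
      ∑ a, ∑ b, star (v a) * v b * ∫ ω, (input ω i a - c.inputMean i a) *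
        star (input ω i b - c.inputMean i b) ∂c.law := by
    intro i
    rw [← integral_complex_ofReal]
    simp_rw [hpt i]
    rw [integral_finsetSum _ fun a _ => integrable_finsetSum _ fun b _ => (hi i a b).const_mul _]
    refine Finset.sum_congr rfl fun a _ => ?_
    rw [integral_finsetSum _ fun b _ => (hi i a b).const_mul _]
    exact Finset.sum_congr rfl fun b _ => integral_const_mul _ _
  rw [Complex.ofReal_mul, Complex.ofReal_sum]
  simp_rw [hint]
  simp only [dotProduct, Matrix.mulVec, inputCov, Matrix.of_apply, Pi.star_apply]
  push_cast
  have hswap : ∀ F : Fin n → Fin t → Fin t → ℂ,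
      ∑ i, ∑ a, ∑ b, F i a b = ∑ a, ∑ b, ∑ i, F i a b := fun F => by
    rw [Finset.sum_comm]
    exact Finset.sum_congr rfl fun a _ => Finset.sum_comm
  rw [hswap]
  simp only [Finset.mul_sum, Finset.sum_mul]
  refine Finset.sum_congr rfl fun a _ => Finset.sum_congr rfl fun b _ =>
    Finset.sum_congr rfl fun i _ => ?_
  ring

theorem quadForm_inputCov
    (hc : ∀ i a, MemLp (fun ω : Sample t n M₁ M₂ => input ω i a) 2 c.law) (v : Fin t → ℂ) :
    quadForm c.inputCov v =
      1 / n * ∑ i, ∫ ω, ‖hdot v (input ω i - c.inputMean i)‖ ^ 2 ∂c.law := by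
  rw [quadForm, c.dotProduct_inputCov_mulVec hc, Complex.ofReal_re]

theorem posSemidef_inputCov
    (hc : ∀ i a, MemLp (fun ω : Sample t n M₁ M₂ => input ω i a) 2 c.law) :
    c.inputCov.PosSemidef := by
  refine Matrix.PosSemidef.of_dotProduct_mulVec_nonneg ?_ fun v => ?_
  · ext a b
    simp only [Matrix.conjTranspose_apply, inputCov, Matrix.of_apply, star_mul', star_sum]
    congr 1
    · simp
    · refine Finset.sum_congr rfl fun i _ => ?_
      have : ∀ f : Sample t n M₁ M₂ → ℂ, star (∫ ω, f ω ∂c.law) = ∫ ω, star (f ω) ∂c.law :=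
        fun f => integral_conj.symm
      rw [this]
      refine integral_congr_ae (ae_of_all _ fun ω => ?_)
      simp [mul_comm]
  · rw [c.dotProduct_inputCov_mulVec hc]
    exact Complex.zero_le_real.2 (mul_nonneg (by positivity)
      (Finset.sum_nonneg fun i _ => integral_nonneg fun ω => by positivity))

/-- The converse for the user with channel `v`, whose message has to be kept secret from the user
with channel `w`, whatever the joint law of the two noises. -/
theorem condEntropy_le_of_channels
    (hc : ∀ i a, MemLp (fun ω : Sample t n M₁ M₂ => input ω i a) 2 c.law) (v w : Fin t → ℂ)
    {M : ℕ} [NeZero M] {W : (Fin M₁ × Fin M₂) × (Fin n → Fin t → ℂ) → Fin M} (hW : Measurable W)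
    {p q : (Fin n → ℂ × ℂ) → Fin n → ℂ} (hp : MeasurePreserving p (noiseLaw n) (blockGaussian n))
    (hq : MeasurePreserving q (noiseLaw n) (blockGaussian n)) {dec : (Fin n → ℂ) → Fin M}
    (hdec : Measurable dec) {η : ℝ} (hη0 : 0 < η) (hη1 : η < 1) {ρ : ℂ} (hρ : ‖ρ‖ < 1) (ν : ℂ)
    (hn : 1 ≤ n) :
    condEntropy c.law (fun ω => W ω.1) (fun ω i => hdot w (input ω i) + q ω.2 i) * Real.log 2 ≤
      -Real.log (1 - η) +
        c.law.real {ω | dec (fun i => hdot v (input ω i) + p ω.2 i) ≠ W ω.1} *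
          (Real.log M - Real.log η) +
      n * Real.log ((quadForm c.inputCov (v - ν • w) + psi ν ρ) / (1 - ‖ρ‖ ^ 2)) := by
  have hA : ∀ u : Fin t → ℂ, Measurable fun (ω : (Fin M₁ × Fin M₂) × (Fin n → Fin t → ℂ)) i =>
      hdot u (ω.2 i) := fun u =>
    measurable_pi_lambda _ fun i => (measurable_hdot u).comp (by fun_prop)
  have hfst : MeasurePreserving (Prod.fst : Sample t n M₁ M₂ → _) c.law c.inputLaw :=
    measurePreserving_fst (μ := c.inputLaw) (ν := noiseLaw n)
  have hx : ∀ i a, MemLp (fun ω : (Fin M₁ × Fin M₂) × (Fin n → Fin t → ℂ) => ω.2 i a) 2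
      c.inputLaw := by
    intro i a
    have := hc i a
    rw [← hfst.map_eq, memLp_map_measure_iff (by fun_prop) hfst.measurable.aemeasurable]
    exact this
  have hA2 : ∀ (u : Fin t → ℂ) (i : Fin n), MemLp
      (fun ω : (Fin M₁ × Fin M₂) × (Fin n → Fin t → ℂ) => hdot u (ω.2 i)) 2 c.inputLaw := by
    intro u i
    simp only [hdot, dotProduct]
    exact memLp_finsetSum _ fun a _ => (hx i a).const_mul _
  have hmp : ∀ {f : (Fin n → ℂ × ℂ) → Fin n → ℂ},
      MeasurePreserving f (noiseLaw n) (blockGaussian n) →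
      MeasurePreserving (Prod.map (id : (Fin M₁ × Fin M₂) × (Fin n → Fin t → ℂ) → _) f) c.law
        (c.inputLaw.prod (blockGaussian n)) := fun hf => (MeasurePreserving.id _).prod hf
  -- Since `hdot` conjugates its left argument, `v - ν w` corresponds to the estimate with
  -- coefficient `star ν`. The constant is the mean of the residual, so that the covariance appears
  -- and not the uncentred second moment.
  have hmain := condEntropy_le_of_decoder hW (hA v) (hA w) (hA2 v) (hA2 w) hdec hη0 hη1
    (ρ := star ρ) (by rwa [norm_star]) (star ν)
    (fun i => hdot v (c.inputMean i) - star ν * hdot w (c.inputMean i)) hn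
  have hset : MeasurableSet {ω : ((Fin M₁ × Fin M₂) × (Fin n → Fin t → ℂ)) × (Fin n → ℂ) |
      dec ((fun i => hdot v (ω.1.2 i)) + ω.2) ≠ W ω.1} :=
    (measurableSet_eq_fun (hdec.comp (((hA v).comp measurable_fst).add measurable_snd))
      (hW.comp measurable_fst)).compl
  have hent : condEntropy c.law (fun ω => W ω.1) (fun ω i => hdot w (input ω i) + q ω.2 i) =
      condEntropy (c.inputLaw.prod (blockGaussian n)) (fun ω => W ω.1)
        (fun ω => (fun i => hdot w (ω.1.2 i)) + ω.2) := by
    have hY : Measurable fun ω : ((Fin M₁ × Fin M₂) × (Fin n → Fin t → ℂ)) × (Fin n → ℂ) =>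
        (fun i => hdot w (ω.1.2 i)) + ω.2 := ((hA w).comp measurable_fst).add measurable_snd
    have hYq : Measurable fun (ω : Sample t n M₁ M₂) i => hdot w (input ω i) + q ω.2 i :=
      ((hA w).comp measurable_fst).add (hq.measurable.comp measurable_snd)
    have hW₁ : Measurable fun ω : Sample t n M₁ M₂ => W ω.1 := hW.comp measurable_fst
    have hW₂ : Measurable fun ω : ((Fin M₁ × Fin M₂) × (Fin n → Fin t → ℂ)) × (Fin n → ℂ) =>
        W ω.1 := hW.comp measurable_fst
    have hlaw : c.law.map (fun ω : Sample t n M₁ M₂ =>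
          ((fun i => hdot w (input ω i) + q ω.2 i : Fin n → ℂ), W ω.1)) =
        (c.inputLaw.prod (blockGaussian n)).map
          (fun ω => ((fun i => hdot w (ω.1.2 i)) + ω.2, W ω.1)) := by
      rw [← (hmp hq).map_eq, Measure.map_map (hY.prodMk hW₂) (hmp hq).measurable]
      rfl
    exact condEntropy_congr_law hW₁ hYq hW₂ hY hlaw
  have herr : c.law.real {ω | dec (fun i => hdot v (input ω i) + p ω.2 i) ≠ W ω.1} =
      (c.inputLaw.prod (blockGaussian n)).real {ω | dec ((fun i => hdot v (ω.1.2 i)) + ω.2) ≠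
        W ω.1} := by
    rw [measureReal_def, measureReal_def, ← (hmp hp).measure_preimage hset.nullMeasurableSet]
    rfl
  have hquad : quadForm c.inputCov (v - ν • w) = 1 / n * ∑ i, ∫ ω, ‖hdot v (ω.2 i) -
      star ν * hdot w (ω.2 i) -
        (hdot v (c.inputMean i) - star ν * hdot w (c.inputMean i))‖ ^ 2 ∂c.inputLaw := by
    rw [c.quadForm_inputCov hc]
    congr 1
    refine Finset.sum_congr rfl fun i _ => ?_
    rw [← hfst.map_eq, integral_map hfst.measurable.aemeasurable]
    · refine integral_congr_ae (ae_of_all _ fun ω => ?_)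
      simp only [hdot_sub_right, hdot_sub_smul_left, input]
    · have h1 := fun u => (measurable_pi_apply i).comp (hA u)
      have h2 := h1 v
      have h3 := h1 w
      simp only [Function.comp_def] at h2 h3
      exact Measurable.aestronglyMeasurable (by fun_prop)
  rw [hent, herr, hquad, psi_eq]
  simpa using hmain

end SecretCode

end Codes

/-! ### From codes to the capacity region -/

section Region

open Filter Topology

variable {t : ℕ}

/-- The penalty of a code with error probability and leakage rate at most `ε` in the bound on its
rate `R`. -/
noncomputable def slack (ε R : ℝ) : ℝ :=
  ε * Real.log 2 * (1 + R) - Real.log (1 - ε) - ε * Real.log ε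

theorem rate_mul_log_two_le {n M : ℕ} (hn : 1 ≤ n) (hM : 1 ≤ M) {R H ε e T : ℝ} (hε0 : 0 < ε)
    (hε1 : ε < 1) (hleak : n * R - H ≤ n * ε) (hMR : (M : ℝ) ≤ 2 ^ ((n : ℝ) * R)) (he : e ≤ ε)
    (hH : H * Real.log 2 ≤ -Real.log (1 - ε) + e * (Real.log M - Real.log ε) + n * T) :
    R * Real.log 2 ≤ T + slack ε R := by
  have hn1 : (1 : ℝ) ≤ n := by exact_mod_cast hn
  have hl2 := Real.log_pos one_lt_two
  have hM1 : (1 : ℝ) ≤ M := by exact_mod_cast hM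
  have hlM : Real.log M ≤ n * R * Real.log 2 := by
    rw [← Real.log_rpow two_pos]
    exact Real.log_le_log (by linarith) hMR
  have hlM0 := Real.log_nonneg hM1
  have hlε : Real.log ε < 0 := Real.log_neg hε0 hε1
  have hl1 : Real.log (1 - ε) < 0 := Real.log_neg (by linarith) (by linarith)
  have h1 : e * (Real.log M - Real.log ε) ≤ ε * (n * R * Real.log 2 - Real.log ε) :=
    (mul_le_mul_of_nonneg_right he (by linarith)).trans
      (mul_le_mul_of_nonneg_left (by linarith) hε0.le)
  have h2 := mul_le_mul_of_nonneg_right hleak hl2.le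
  have h3 : 0 ≤ -Real.log (1 - ε) - ε * Real.log ε := by nlinarith
  -- The terms not proportional to `n` are nonnegative, so `n ≥ 1` absorbs them; block lengths need
  -- not tend to infinity.
  have h4 : -Real.log (1 - ε) - ε * Real.log ε ≤ n * (-Real.log (1 - ε) - ε * Real.log ε) :=
    le_mul_of_one_le_left h3 hn1
  have h5 : n * (R * Real.log 2) ≤ n * (T + slack ε R) := by
    unfold slack
    nlinarith
  exact le_of_mul_le_mul_left h5 (by linarith)

theorem tendsto_slack {ε R : ℕ → ℝ} {R₀ : ℝ} (hε : Tendsto ε atTop (𝓝 0))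
    (hR : Tendsto R atTop (𝓝 R₀)) : Tendsto (fun k => slack (ε k) (R k)) atTop (𝓝 0) := by
  have h1 : Tendsto (fun k => ε k * Real.log 2 * (1 + R k)) atTop (𝓝 (0 * Real.log 2 * (1 + R₀))) :=
    (hε.mul_const _).mul (hR.const_add 1)
  have h2 : Tendsto (fun k => Real.log (1 - ε k)) atTop (𝓝 (Real.log (1 - 0))) :=
    (hε.const_sub 1).log (by norm_num)
  have h3 : Tendsto (fun k => ε k * Real.log (ε k)) atTop (𝓝 (0 * Real.log 0)) :=
    (Real.continuous_mul_log.tendsto 0).comp hε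
  simpa [slack] using (h1.sub h2).sub h3

theorem one_le_numMsg {n : ℕ} {R : ℝ} (hR : 0 ≤ R) : 1 ≤ numMsg n R :=
  Nat.one_le_floor_iff _ |>.2 (Real.one_le_rpow one_le_two (by positivity))

/-- The order of quantifiers matters: `K` is the covariance of a single code and is fixed before `ρ`
and `ν`. The code's tolerance `ε` also serves as the mixing weight in Fano's bound. -/
theorem exists_inputCov_of_achievable {h g : Fin t → ℂ} {P : ℝ} {R : ℝ × ℝ}
    (hR : Achievable h g P R) {ε : ℝ} (hε0 : 0 < ε) (hε1 : ε < 1) :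
    ∃ K : Matrix (Fin t) (Fin t) ℂ, K.PosSemidef ∧ K.trace.re ≤ P ∧
      ∀ ρ : ℂ, ‖ρ‖ < 1 → ∀ ν : ℂ,
        R.1 * Real.log 2 ≤ Real.log ((quadForm K (h - ν • g) + psi ν ρ) / (1 - ‖ρ‖ ^ 2)) +
          slack ε R.1 ∧
        R.2 * Real.log 2 ≤ Real.log ((quadForm K (g - ν • h) + psi ν ρ) / (1 - ‖ρ‖ ^ 2)) +
          slack ε R.2 := by
  obtain ⟨hR1, hR2, hcode⟩ := hR
  obtain ⟨n, hn, c, ⟨hc, htr⟩, herr, hl1, hl2⟩ := hcode ε hε0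
  have hM1 : 1 ≤ numMsg n R.1 := one_le_numMsg hR1
  have hM2 : 1 ≤ numMsg n R.2 := one_le_numMsg hR2
  -- Nonempty message sets make the law of the code a probability measure.
  have : NeZero (numMsg n R.1) := ⟨by omega⟩
  have : NeZero (numMsg n R.2) := ⟨by omega⟩
  refine ⟨c.inputCov, c.posSemidef_inputCov hc, htr, fun ρ hρ ν => ⟨?_, ?_⟩⟩
  · exact rate_mul_log_two_le hn hM1 hε0 hε1 hl1 (Nat.floor_le (by positivity))
      ((le_max_left _ _).trans herr)
      (c.condEntropy_le_of_channels hc h g (W := fun ω => ω.1.1) (by fun_prop)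
        SecretCode.measurePreserving_noise₁ SecretCode.measurePreserving_noise₂ c.measurable_dec₁
        hε0 hε1 hρ ν hn)
  · exact rate_mul_log_two_le hn hM2 hε0 hε1 hl2 (Nat.floor_le (by positivity))
      ((le_max_right _ _).trans herr)
      (c.condEntropy_le_of_channels hc g h (W := fun ω => ω.1.2) (by fun_prop)
        SecretCode.measurePreserving_noise₂ SecretCode.measurePreserving_noise₁ c.measurable_dec₂
        hε0 hε1 hρ ν hn)

/-! ### Compactness of the admissible covariance matrices -/

theorem quadForm_nonneg {K : Matrix (Fin t) (Fin t) ℂ} (hK : K.PosSemidef) (v : Fin t → ℂ) :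
    0 ≤ quadForm K v := (Complex.nonneg_iff.1 (hK.dotProduct_mulVec_nonneg v)).1

theorem continuous_quadForm_left (v : Fin t → ℂ) :
    Continuous fun K : Matrix (Fin t) (Fin t) ℂ => quadForm K v := by
  unfold quadForm; fun_prop

/-- Keeps the argument of the logarithm positive when `|ρ| < 1`, as continuity and monotonicity of
the logarithm require. -/
theorem one_sub_norm_sq_le_psi (ν ρ : ℂ) : 1 - ‖ρ‖ ^ 2 ≤ psi ν ρ := by
  rw [psi_eq]; linarith [sq_nonneg ‖star ρ - star ν‖]

theorem norm_entry_le_trace {K : Matrix (Fin t) (Fin t) ℂ} (hK : K.PosSemidef) (a b : Fin t) :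
    ‖K a b‖ ≤ K.trace.re := by
  have hdiag : ∀ i, 0 ≤ (K i i).re := fun i => (Complex.nonneg_iff.1 hK.diag_nonneg).1
  have hle : ∀ i, (K i i).re ≤ K.trace.re := fun i => by
    rw [Matrix.trace, Complex.re_sum]
    exact Finset.single_le_sum (f := fun i => (K.diag i).re) (fun j _ => hdiag j)
      (Finset.mem_univ i)
  by_cases h0 : K a b = 0
  · rw [h0, norm_zero]; exact (hdiag a).trans (hle a)
  have hn : ‖K a b‖ ≠ 0 := norm_ne_zero_iff.2 h0
  have hn' : (‖K a b‖ : ℂ) ≠ 0 := Complex.ofReal_ne_zero.2 hn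
  -- The phase is chosen so that the form at `e_a + β e_b` equals `K a a + K b b - 2 |K a b|`; its
  -- nonnegativity bounds the entry.
  set β : ℂ := -(star (K a b) / ‖K a b‖) with hβ
  have hβ1 : star β * β = 1 := by
    have : star (K a b) * K a b = (‖K a b‖ : ℂ) ^ 2 := by
      rw [mul_comm]; exact Complex.mul_conj' _
    have h2 : star (‖K a b‖ : ℂ) = ‖K a b‖ := Complex.conj_ofReal _
    rw [hβ, star_neg, star_div₀, star_star, h2, neg_mul_neg, div_mul_div_comm, mul_comm (K a b),
      this, sq, div_self (mul_ne_zero hn' hn')]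
  have hKβ : K a b * β = -(‖K a b‖ : ℂ) := by
    rw [hβ, mul_neg, ← mul_div_assoc]
    congr 1
    rw [show K a b * star (K a b) = (‖K a b‖ : ℂ) ^ 2 from Complex.mul_conj' _]
    field_simp
  have hβK : star β * K b a = -(‖K a b‖ : ℂ) := by
    rw [← hK.1.apply b a, ← star_mul, hKβ, star_neg]
    congr 1
    exact Complex.conj_ofReal _
  have hq := quadForm_nonneg hK (Pi.single a 1 + Pi.single b β)
  have hval : star (Pi.single a 1 + Pi.single b β : Fin t → ℂ) ⬝ᵥ
      K.mulVec (Pi.single a 1 + Pi.single b β) = K a a + K b b - 2 * ‖K a b‖ := by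
    have hs1 : star (Pi.single a 1 : Fin t → ℂ) = Pi.single a 1 := by
      rw [← Pi.single_star, star_one]
    rw [star_add, hs1, ← Pi.single_star, Matrix.mulVec_add, add_dotProduct,
      single_dotProduct, single_dotProduct]
    simp only [Pi.add_apply, Matrix.mulVec_single, Matrix.col_apply, Pi.smul_apply,
      MulOpposite.smul_eq_mul_unop, MulOpposite.unop_op, mul_one, one_mul]
    linear_combination hKβ + hβK + K b b * hβ1
  rw [quadForm, hval] at hq
  simp only [Complex.sub_re, Complex.add_re, Complex.mul_re, Complex.ofReal_re,
    Complex.ofReal_im, Complex.re_ofNat, Complex.im_ofNat, mul_zero, sub_zero] at hq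
  linarith [hle a, hle b]

theorem exists_tendsto_subseq_posSemidef {P : ℝ} {K : ℕ → Matrix (Fin t) (Fin t) ℂ}
    (hK : ∀ k, (K k).PosSemidef) (hP : ∀ k, (K k).trace.re ≤ P) :
    ∃ K₀ : Matrix (Fin t) (Fin t) ℂ, K₀.PosSemidef ∧ K₀.trace.re ≤ P ∧
      ∃ φ : ℕ → ℕ, StrictMono φ ∧ Tendsto (K ∘ φ) atTop (𝓝 K₀) := by
  have hcomp : IsCompact (Set.univ.pi fun _ : Fin t => Set.univ.pi fun _ : Fin t =>
      Metric.closedBall (0 : ℂ) P) :=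
    isCompact_univ_pi fun _ => isCompact_univ_pi fun _ => isCompact_closedBall 0 P
  obtain ⟨K₀, -, φ, hφ, hlim⟩ := hcomp.tendsto_subseq (x := fun k a b => K k a b) fun k => by
    simp only [Set.mem_univ_pi, mem_closedBall_zero_iff]
    exact fun a b => (norm_entry_le_trace (hK k) a b).trans (hP k)
  have hlim' : Tendsto (K ∘ φ) atTop (𝓝 (Matrix.of K₀)) := hlim
  refine ⟨Matrix.of K₀, ?_, ?_, φ, hφ, hlim'⟩
  · refine Matrix.PosSemidef.of_dotProduct_mulVec_nonneg ?_ fun v => ?_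
    · have h1 : Tendsto (fun k => (K (φ k)).conjTranspose) atTop
          (𝓝 (Matrix.of K₀).conjTranspose) :=
        ((continuous_id.matrix_conjTranspose).tendsto _).comp hlim'
      refine tendsto_nhds_unique h1 ?_
      simp_rw [fun k => (hK (φ k)).1.eq]
      exact hlim'
    · have hcont : Continuous fun M : Matrix (Fin t) (Fin t) ℂ => star v ⬝ᵥ M.mulVec v := by
        fun_prop
      exact ge_of_tendsto' ((hcont.tendsto _).comp hlim') fun k =>
        (hK (φ k)).dotProduct_mulVec_nonneg v
  · have hcont : Continuous fun M : Matrix (Fin t) (Fin t) ℂ => M.trace.re := by fun_prop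
    exact le_of_tendsto' ((hcont.tendsto _).comp hlim') fun k => hP (φ k)

/-- A rate pair in the secrecy capacity region satisfies, with a single admissible covariance
matrix, the bounds for all noise correlations in the open unit disc. -/
theorem exists_covariance_of_mem_region {h g : Fin t → ℂ} {P : ℝ} {R : ℝ × ℝ}
    (hR : R ∈ secrecyCapacityRegion h g P) :
    0 ≤ R.1 ∧ 0 ≤ R.2 ∧ ∃ K : Matrix (Fin t) (Fin t) ℂ, K.PosSemidef ∧ K.trace.re ≤ P ∧
      ∀ ρ : ℂ, ‖ρ‖ < 1 → ∀ ν : ℂ,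
        R.1 * Real.log 2 ≤ Real.log ((quadForm K (h - ν • g) + psi ν ρ) / (1 - ‖ρ‖ ^ 2)) ∧
        R.2 * Real.log 2 ≤ Real.log ((quadForm K (g - ν • h) + psi ν ρ) / (1 - ‖ρ‖ ^ 2)) := by
  obtain ⟨Q, hQ, hlim⟩ := mem_closure_iff_seq_limit.1 hR
  have hlim1 : Tendsto (fun k => (Q k).1) atTop (𝓝 R.1) := (continuous_fst.tendsto R).comp hlim
  have hlim2 : Tendsto (fun k => (Q k).2) atTop (𝓝 R.2) := (continuous_snd.tendsto R).comp hlim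
  refine ⟨ge_of_tendsto' hlim1 fun k => (hQ k).1, ge_of_tendsto' hlim2 fun k => (hQ k).2.1, ?_⟩
  -- The shift to `1 / (k + 2)` keeps every tolerance strictly below one, as `log (1 - ε)` requires.
  have hε0 : ∀ k : ℕ, (0 : ℝ) < 1 / ((k + 1 : ℕ) + 1) := fun k => by positivity
  have hε1 : ∀ k : ℕ, (1 : ℝ) / ((k + 1 : ℕ) + 1) < 1 := fun k => by
    rw [div_lt_one (by positivity)]
    push_cast
    linarith [Nat.cast_nonneg (α := ℝ) k]
  have hε : Tendsto (fun k : ℕ => (1 : ℝ) / ((k + 1 : ℕ) + 1)) atTop (𝓝 0) :=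
    tendsto_one_div_add_atTop_nhds_zero_nat.comp (tendsto_add_atTop_nat 1)
  choose K hK hP hb using fun k => exists_inputCov_of_achievable (hQ k) (hε0 k) (hε1 k)
  obtain ⟨K₀, hK₀, hP₀, φ, hφ, hKlim⟩ := exists_tendsto_subseq_posSemidef hK hP
  refine ⟨K₀, hK₀, hP₀, fun ρ hρ ν => ?_⟩
  have hs2 : 0 < 1 - ‖ρ‖ ^ 2 := by nlinarith [norm_nonneg ρ]
  have hlog : ∀ v : Fin t → ℂ, Tendsto
      (fun k => Real.log ((quadForm (K (φ k)) v + psi ν ρ) / (1 - ‖ρ‖ ^ 2))) atTop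
      (𝓝 (Real.log ((quadForm K₀ v + psi ν ρ) / (1 - ‖ρ‖ ^ 2)))) := by
    intro v
    have hq := ((continuous_quadForm_left v).tendsto K₀).comp hKlim
    refine ((hq.add_const _).div_const _).log (ne_of_gt (div_pos ?_ hs2))
    linarith [quadForm_nonneg hK₀ v, one_sub_norm_sq_le_psi ν ρ]
  have hφ' := hφ.tendsto_atTop
  have hR1 := hlim1.comp hφ'
  have hR2 := hlim2.comp hφ'
  constructor
  · refine le_of_tendsto_of_tendsto' (hR1.mul_const (Real.log 2)) ?_
      fun k => (hb (φ k) ρ hρ ν).1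
    simpa using (hlog (h - ν • g)).add (tendsto_slack (hε.comp hφ') hR1)
  · refine le_of_tendsto_of_tendsto' (hR2.mul_const (Real.log 2)) ?_
      fun k => (hb (φ k) ρ hρ ν).2
    simpa using (hlog (g - ν • h)).add (tendsto_slack (hε.comp hφ') hR2)

/-! ### Existence of the minima and the boundary case `|ρ| = 1` -/

theorem psi_of_norm_eq_one {ν ρ : ℂ} (hρ : ‖ρ‖ = 1) : psi ν ρ = ‖ρ - ν‖ ^ 2 := by
  rw [psi_eq, hρ, ← star_sub, norm_star]; ring

/-- For `|ρ| < 1` the numerator is continuous and coercive, since `ψ` grows like `|ν|²`. For `|ρ| =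
1` the objective takes only the values `0` and `⊤`, so a minimizer is a zero of the numerator if
there is one, and any point otherwise. -/
theorem exists_isMinOn_obj (v w : Fin t → ℂ) {ρ : ℂ} (hρ : ‖ρ‖ ≤ 1)
    {K : Matrix (Fin t) (Fin t) ℂ} (hK : K.PosSemidef) :
    ∃ ν₀, ∀ ν, logRatio (quadForm K (v - ν₀ • w) + psi ν₀ ρ) (1 - ‖ρ‖ ^ 2) ≤
      logRatio (quadForm K (v - ν • w) + psi ν ρ) (1 - ‖ρ‖ ^ 2) := by
  rcases hρ.eq_or_lt with h1 | h1
  · simp only [logRatio, h1, one_pow, sub_self, if_true]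
    by_cases hz : ∃ ν₀, quadForm K (v - ν₀ • w) + psi ν₀ ρ = 0
    · obtain ⟨ν₀, hν₀⟩ := hz
      refine ⟨ν₀, fun ν => ?_⟩
      rw [if_pos hν₀]
      split_ifs <;> simp
    · push Not at hz
      exact ⟨0, fun ν => by rw [if_neg (hz ν), if_neg (hz 0)]⟩
  · have hs2 : 0 < 1 - ‖ρ‖ ^ 2 := by nlinarith [norm_nonneg ρ]
    have hcont : Continuous fun ν : ℂ => quadForm K (v - ν • w) + psi ν ρ := by
      unfold quadForm psi; fun_prop
    have hcoer : Tendsto (fun ν : ℂ => quadForm K (v - ν • w) + psi ν ρ) (cocompact ℂ) atTop := by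
      have h2 : Tendsto (fun ν : ℂ => ‖ν‖ - ‖ρ‖) (cocompact ℂ) atTop :=
        tendsto_atTop_add_const_right _ _ (tendsto_norm_cocompact_atTop)
      have h3 : Tendsto (fun ν : ℂ => (‖ν‖ - ‖ρ‖) ^ 2) (cocompact ℂ) atTop :=
        (tendsto_pow_atTop two_ne_zero).comp h2
      refine tendsto_atTop_mono (fun ν => ?_) h3
      have h4 : (‖ν‖ - ‖ρ‖) ^ 2 ≤ ‖star ρ - star ν‖ ^ 2 := by
        rw [← star_sub, norm_star, norm_sub_rev, ← sq_abs (‖ν‖ - ‖ρ‖)]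
        exact pow_le_pow_left₀ (abs_nonneg _) (abs_norm_sub_norm_le _ _) 2
      rw [psi_eq]
      linarith [quadForm_nonneg hK (v - ν • w)]
    obtain ⟨ν₀, hν₀⟩ := hcont.exists_forall_le hcoer
    refine ⟨ν₀, fun ν => ?_⟩
    simp only [logRatio, if_neg hs2.ne', EReal.coe_le_coe_iff]
    refine Real.logb_le_logb_of_le one_lt_two (div_pos ?_ hs2)
      (div_le_div_of_nonneg_right (hν₀ ν) hs2.le)
    linarith [quadForm_nonneg hK (v - ν₀ • w), one_sub_norm_sq_le_psi ν₀ ρ]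

theorem isLeast_range_iInf_of_exists_forall_le {α ι : Type*} [CompleteLattice α] {f : ι → α}
    (hf : ∃ i, ∀ j, f i ≤ f j) : IsLeast (Set.range f) (⨅ i, f i) := by
  obtain ⟨i, hi⟩ := hf
  exact ⟨⟨i, le_antisymm (le_iInf hi) (iInf_le f i)⟩, fun _ ⟨j, hj⟩ => hj ▸ iInf_le f j⟩

theorem nonpos_of_forall_le_log {R : ℝ}
    (h : ∀ s : ℝ, 0 ≤ s → s < 1 → R * Real.log 2 ≤ Real.log (2 / (1 + s))) : R ≤ 0 := by
  have hlim : Tendsto (fun s : ℝ => Real.log (2 / (1 + s))) (𝓝[<] 1)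
      (𝓝 (Real.log (2 / (1 + 1)))) := by
    refine Tendsto.mono_left ?_ nhdsWithin_le_nhds
    refine (ContinuousAt.div (by fun_prop) (by fun_prop) (by norm_num)).log (by norm_num)
  have hle : R * Real.log 2 ≤ Real.log (2 / (1 + 1)) := by
    refine ge_of_tendsto hlim ?_
    filter_upwards [Ioo_mem_nhdsLT (show (0 : ℝ) < 1 by norm_num)] with s hs
    exact h s hs.1.le hs.2
  rw [show (2 : ℝ) / (1 + 1) = 1 by norm_num, Real.log_one] at hle
  exact nonpos_of_mul_nonpos_left hle (Real.log_pos one_lt_two)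

theorem coe_rate_le_iInf_logRatio (v w : Fin t → ℂ) {ρ : ℂ} (hρ : ‖ρ‖ ≤ 1)
    {K : Matrix (Fin t) (Fin t) ℂ} (hK : K.PosSemidef) {R : ℝ}
    (h : ∀ ρ : ℂ, ‖ρ‖ < 1 → ∀ ν : ℂ,
      R * Real.log 2 ≤ Real.log ((quadForm K (v - ν • w) + psi ν ρ) / (1 - ‖ρ‖ ^ 2))) :
    (R : EReal) ≤ ⨅ ν : ℂ, logRatio (quadForm K (v - ν • w) + psi ν ρ) (1 - ‖ρ‖ ^ 2) := by
  refine le_iInf fun ν => ?_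
  rcases hρ.eq_or_lt with h1 | h1
  · simp only [logRatio, h1, one_pow, sub_self, if_true]
    split_ifs with hz
    · have hq := quadForm_nonneg hK (v - ν • w)
      rw [psi_of_norm_eq_one h1] at hz
      -- Both summands of the numerator are nonnegative, so the finite value `0` can occur only at
      -- `ν = ρ`, with vanishing quadratic form.
      have hν : ρ - ν = 0 := by
        rw [← norm_eq_zero, ← sq_eq_zero_iff]
        nlinarith [sq_nonneg ‖ρ - ν‖]
      have hq0 : quadForm K (v - ν • w) = 0 := by nlinarith [sq_nonneg ‖ρ - ν‖]
      rw [← sub_eq_zero.1 hν] at hq0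
      refine EReal.coe_nonpos.2 (nonpos_of_forall_le_log fun s hs0 hs1 => ?_)
      have hn : ‖(s : ℂ) * ρ‖ = s := by
        rw [norm_mul, h1, mul_one, Complex.norm_real, Real.norm_of_nonneg hs0]
      -- Approach the boundary radially, keeping the estimator at `ρ`: the ratio becomes `(2 - 2 s)
      -- / (1 - s²) = 2 / (1 + s)`, which tends to `1` and forces `R ≤ 0`.
      have hb := h ((s : ℂ) * ρ) (by rwa [hn]) ρ
      have hpsi : psi ρ ((s : ℂ) * ρ) = 2 - 2 * s := by
        have : ‖star ((s : ℂ) * ρ) - star ρ‖ ^ 2 = (1 - s) ^ 2 := by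
          rw [← star_sub, norm_star, ← sub_one_mul, norm_mul, h1, mul_one, norm_sub_rev,
            ← Complex.ofReal_one, ← Complex.ofReal_sub, Complex.norm_real, Real.norm_eq_abs,
            sq_abs]
        rw [psi_eq, this, hn]
        ring
      rw [hq0, hpsi, hn] at hb
      convert hb using 2
      have h1s : (1 : ℝ) - s ≠ 0 := by linarith
      have h1s' : (1 : ℝ) + s ≠ 0 := by linarith
      rw [show 1 - s ^ 2 = (1 - s) * (1 + s) by ring]
      field_simp
      ring
    · exact le_top
  · have hs2 : 0 < 1 - ‖ρ‖ ^ 2 := by nlinarith [norm_nonneg ρ]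
    simp only [logRatio, if_neg hs2.ne', EReal.coe_le_coe_iff]
    rw [Real.logb, le_div_iff₀ (Real.log_pos one_lt_two)]
    exact h ρ h1 ν

end Region

end MGBC

/-- Sato-type outer bound on the secrecy capacity region of the two-user multi-antenna Gaussian
broadcast channel with confidential messages. The first conjunct says that the minima which define
`f₁` and `f₂` exist. -/
theorem lemma5 (t : ℕ) (ht : 2 ≤ t) (h g : Fin t → ℂ) (P : ℝ) (hP : 0 ≤ P)
    (ρ : ℂ) (hρ : ‖ρ‖ ≤ 1) :
    (∀ K : Matrix (Fin t) (Fin t) ℂ, K.PosSemidef →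
      IsLeast (Set.range (MGBC.obj₁ h g ρ K)) (MGBC.f₁ h g ρ K) ∧
      IsLeast (Set.range (MGBC.obj₂ h g ρ K)) (MGBC.f₂ h g ρ K)) ∧
    MGBC.secrecyCapacityRegion h g P ⊆
      ⋃ K ∈ {K : Matrix (Fin t) (Fin t) ℂ | K.PosSemidef ∧ K.trace.re ≤ P},
        MGBC.outerRegion h g ρ K := by
  refine ⟨fun K hK => ⟨MGBC.isLeast_range_iInf_of_exists_forall_le
    (MGBC.exists_isMinOn_obj h g hρ hK), MGBC.isLeast_range_iInf_of_exists_forall_le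
    (MGBC.exists_isMinOn_obj g h hρ hK)⟩, fun R hR => ?_⟩
  obtain ⟨hR1, hR2, K, hK, hKP, hb⟩ := MGBC.exists_covariance_of_mem_region hR
  refine Set.mem_biUnion (x := K) ⟨hK, hKP⟩ ⟨hR1, ?_, hR2, ?_⟩
  · exact MGBC.coe_rate_le_iInf_logRatio h g hρ hK fun ρ' hρ' ν => (hb ρ' hρ' ν).1
  · exact MGBC.coe_rate_le_iInf_logRatio g h hρ hK fun ρ' hρ' ν => (hb ρ' hρ' ν).2
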